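/- Let $Act$ be a set of actions and let processes be the states of a labelled transition system over $Act$; $p$ is image-finite if for every state $p'$ reachable from $p$ and every $a\in Act$ the set $\{p''\mid p'\xrightarrow{a}p''\}$ is finite. Hennessy--Milner formulas are built from conjunctions $\bigwedge_{i\in I}\varphi_i$ over arbitrary index sets, prefixes $a\varphi$ and negations $\neg\varphi$, with the usual satisfaction relation; $\top$ is the empty conjunction and $0=\bigwedge_{a\in Act}\neg a\top$. A set $\mathcal L$ of formulas induces the preorder $p\sqsubseteq_{\mathcal L}q$ iff every $\varphi\in\mathcal L$ satisfied by $p$ is satisfied by $q$. *Constraints.* For $N\in\{U,C,I,T,S\}$ let $\mathcal L'_U=\{\top\}$, $\mathcal L'_C=\{\top,\neg 0\}$, $\mathcal L'_I=\{\top,\neg 0\}\cup\{a\top\mid a\in Act\}$, let $\mathcal L'_T$ be the least set containing $\top$ and closed under $\varphi\mapsto a\varphi$, and $\mathcal L'_S=\mathcal L'_{US}$ (defined next). Let $\mathcal L_N^{\equiv}$, $\mathcal L_N^{\neg}$, $\mathcal L_N^{\surd}$ be the closures under arbitrary conjunctions of $\{\sigma,\neg\sigma\mid\sigma\in\mathcal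 L'_N\}$, $\{\neg\sigma\mid\sigma\in\mathcal L'_N\}$ and $\mathcal L'_N$. *Logics.* The following are the least sets of formulas such that: - $\mathcal L'_{NS}$ ($N$-simulation) contains $\sigma$ and $\neg\sigma$ for $\sigma\in\mathcal L'_N$ and is closed under arbitrary conjunctions and prefixes; - $\mathcal L'_{\leq_N^{l}}$ ($N$-ready trace), $\mathcal L'_{\leq_N^{l\supseteq}}$ ($N$-failure trace), $\mathcal L'_{\leq_N^{l\subseteq}}$ (partial offer trace) contain $\top$ and are closed under prefixes and under $\varphi\mapsto\sigma\wedge\varphi$ for $\sigma$ in $\mathcal L_N^{\equiv}$, $\mathcal L_N^{\neg}$, $\mathcal L_N^{\surd}$, respectively; - $\mathcal L'_{\leq_N^{lf}}$ ($N$-readiness), $\mathcal L'_{\leq_N^{lf\supseteq}}$ ($N$-failures), $\mathcal L'_{\leq_N^{lf\subseteq}}$ (partial offers) contain $\top$ and all of $\mathcal L_N^{\equiv}$, $\mathcal L_N^{\neg}$, $\mathcal L_N^{\surd}$, respectively, and are closed under prefixes; - $\mathcal L'_{D_N}$ (deterministic branching) contains $\top$ and is closed under $\varphi\mapsto\sigma\wedge\varphi$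 for $\sigma\in\mathcal L_N^{\equiv}$ and under forming $\bigwedge_{a\in X}a\varphi_a$ for $X\subseteq Act$. The finitary fragment $\mathcal L^f_{\mathcal Y_N}$ consists of the formulas of $\mathcal L'_{\mathcal Y_N}$ all of whose conjunctions are finite. *Observations.* The local observation $L_N(p)$ is: trivial for $U$; for $C$, the truth value of "$p$ has no transition"; for $I$, the set of initial actions of $p$; for $T$, the set of traces of $p$; for $S$, the simulation-equivalence class of $p$. The set $BGO_N(p)$ of branching general observations consists of the finite trees $\langle L_N(p),S\rangle$ with $S$ a finite set of pairs $(a,o)$ such that $o\in BGO_N(p')$ for some $p\xrightarrow{a}p'$; $dBGO_N(p)$ is the set of those in which distinct children of a node always have distinct arc labels; $LGO_N(p)$ is the set of those in which every node has at most one child, written $X_0a_1X_1\dots a_nX_n$. On local observations, $X\supseteq Y$ means equality for $N\in\{U,C\}$, set inclusion for $N\in\{I,T\}$, and $Y\leq_S X$ in the simulation order on classes for $N=S$; $X\subseteq Y$ means equality for $N=U$, set inclusion for $N\in\{I,T\}$, $X\leq_S Y$ for $N=S$, and, for $N=C$, that if $Y$ is the observation of a terminated process then so is $X$. *Observational preorders.*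 For $NS$: $BGO_N(p)\subseteq BGO_N(q)$. For $D_N$: $dBGO_N(p)\subseteq dBGO_N(q)$. For $\leq_N^l$: $LGO_N(p)\subseteq LGO_N(q)$. For $\leq_N^{l\supseteq}$, $\leq_N^{l\subseteq}$, $\leq_N^{lf}$, $\leq_N^{lf\supseteq}$, $\leq_N^{lf\subseteq}$: for every $X_0a_1X_1\dots a_nX_n\in LGO_N(p)$ there is $Y_0a_1Y_1\dots a_nY_n\in LGO_N(q)$ (same actions) with, respectively, $X_i\supseteq Y_i$ for all $i\le n$; $X_i\subseteq Y_i$ for all $i\le n$; $X_n=Y_n$; $X_n\supseteq Y_n$; $X_n\subseteq Y_n$. **Theorem.** Let $N\in\{U,C,I,T,S\}$ and $\mathcal Y_N\in\{NS,\leq_N^{l},\leq_N^{l\supseteq},\leq_N^{lf},\leq_N^{lf\supseteq},\leq_N^{l\subseteq},\leq_N^{lf\subseteq},D_N\}$, and let $p,q$ be image-finite processes. Then: 1. $p\sqsubseteq_{\mathcal L'_{\mathcal Y_N}}q$ if and only if $p$ is below $q$ in the observational preorder of $\mathcal Y_N$; 2. if moreover $Act$ is finite in case $N=C$, then $p\sqsubseteq_{\mathcal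 L^f_{\mathcal Y_N}}q$ if and only if $p$ is below $q$ in the observational preorder of $\mathcal Y_N$; 3. the observational preorder is also the inclusion of the sets of observations of $p$ and $q$, where for $\leq_N^{l\supseteq}$, $\leq_N^{l\subseteq}$, $\leq_N^{lf}$, $\leq_N^{lf\supseteq}$, $\leq_N^{lf\subseteq}$ each set $\mathcal T=LGO_N(\cdot)$ is first replaced by its closure, the set of all $X_0a_1X_1\dots a_nX_n$ for which there is $Y_0a_1Y_1\dots a_nY_n\in\mathcal T$ related to it as in the definition of that preorder. -/

import Mathlib

universe u v w

/-! ### Labelled transition systems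

A process is a state `p : P` of a labelled transition system given by its transition relation
`tr : P → Act → P → Prop`, where `tr p a p'` means `p --a--> p'`. -/

section LTS

variable {Act : Type u} {P : Type v}

/-- `Steps tr p α q`: the process `p` can perform the sequence of actions `α` and become `q`. -/
inductive Steps (tr : P → Act → P → Prop) : P → List Act → P → Prop
  | nil (p : P) : Steps tr p [] p
  | cons {p p' q : P} {a : Act} {α : List Act} :
      tr p a p' → Steps tr p' α q → Steps tr p (a :: α) q

/-- `p` is image-finite: no state reachable from `p` has infinitely many successors under one
and the same action. -/
def ImageFinite (tr : P → Act → P → Prop) (p : P) : Prop :=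
  ∀ (α : List Act) (p' : P), Steps tr p α p' → ∀ a : Act, {p'' : P | tr p' a p''}.Finite

/-- The initial offer `I(p)`. -/
def initials (tr : P → Act → P → Prop) (p : P) : Set Act :=
  {a | ∃ p', tr p a p'}

/-- The set of traces `T(p)`. -/
def traces (tr : P → Act → P → Prop) (p : P) : Set (List Act) :=
  {α | ∃ p', Steps tr p α p'}

/-- `R` is a (plain) simulation. -/
def IsSimulation (tr : P → Act → P → Prop) (R : P → P → Prop) : Prop :=
  ∀ p q, R p q → ∀ a p', tr p a p' → ∃ q', tr q a q' ∧ R p' q'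

/-- The simulation preorder `p ⊑_S q`. -/
def SimLE (tr : P → Act → P → Prop) (p q : P) : Prop :=
  ∃ R : P → P → Prop, IsSimulation tr R ∧ R p q

theorem SimLE.refl (tr : P → Act → P → Prop) (p : P) : SimLE tr p p :=
  ⟨Eq, by rintro p _ rfl a p' h; exact ⟨p', h, rfl⟩, rfl⟩

theorem SimLE.trans {tr : P → Act → P → Prop} {p q r : P}
    (h₁ : SimLE tr p q) (h₂ : SimLE tr q r) : SimLE tr p r := by
  obtain ⟨R, hR, hpq⟩ := h₁
  obtain ⟨Q, hQ, hqr⟩ := h₂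
  refine ⟨fun x z => ∃ y, R x y ∧ Q y z, ?_, q, hpq, hqr⟩
  rintro x z ⟨y, hxy, hyz⟩ a x' hx
  obtain ⟨y', hy', hR'⟩ := hR x y hxy a x' hx
  obtain ⟨z', hz', hQ'⟩ := hQ y z hyz a y' hy'
  exact ⟨z', hz', y', hR', hQ'⟩

/-- Simulation equivalence. -/
def simSetoid (tr : P → Act → P → Prop) : Setoid P where
  r p q := SimLE tr p q ∧ SimLE tr q p
  iseqv :=
    { refl := fun p => ⟨SimLE.refl tr p, SimLE.refl tr p⟩
      symm := fun h => ⟨h.2, h.1⟩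
      trans := fun h k => ⟨h.1.trans k.1, k.2.trans h.2⟩ }

/-- The order on simulation classes: `[[p]]_S ≤_S [[q]]_S` iff `p ⊑_S q`. -/
def simClassLE (tr : P → Act → P → Prop) (x y : Quotient (simSetoid tr)) : Prop :=
  Quotient.liftOn₂ x y (SimLE tr) (fun _ _ _ _ h k => propext
    ⟨fun e => (h.2.trans e).trans k.1, fun e => (h.1.trans e).trans k.2⟩)

end LTS

/-! ### Branching general observations

Finite trees with arcs labelled by actions, nodes labelled by local observations, and, at every
node, a finite *set* of pairs (arc, subtree). -/

section BGO

variable {Act : Type u} {L : Type v}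

/-- Presentations of finite labelled trees, with an indexed family of children at every node. -/
inductive PreBGO (Act : Type u) (L : Type v) : Type (max u v)
  | node (l : L) (n : ℕ) (a : Fin n → Act) (t : Fin n → PreBGO Act L) : PreBGO Act L

/-- Two presentations denote the same tree when their roots carry the same label and their
families of children have the same range, recursively. -/
def PreBGO.Equiv : PreBGO Act L → PreBGO Act L → Prop
  | .node l n a t, .node l' n' a' t' =>
      l = l' ∧
      (∀ i : Fin n, ∃ j : Fin n', a i = a' j ∧ PreBGO.Equiv (t i) (t' j)) ∧
      (∀ j : Fin n', ∃ i : Fin n, a i = a' j ∧ PreBGO.Equiv (t i) (t' j))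

theorem PreBGO.Equiv.refl (x : PreBGO Act L) : PreBGO.Equiv x x := by
  induction x with
  | node l n a t ih => exact ⟨rfl, fun i => ⟨i, rfl, ih i⟩, fun i => ⟨i, rfl, ih i⟩⟩

theorem PreBGO.Equiv.symm {x y : PreBGO Act L} (h : PreBGO.Equiv x y) : PreBGO.Equiv y x := by
  induction x generalizing y with
  | node l n a t ih =>
    cases y with
    | node l' n' a' t' =>
      obtain ⟨h₀, h₁, h₂⟩ := h
      refine ⟨h₀.symm, fun j => ?_, fun i => ?_⟩
      · obtain ⟨i, e, k⟩ := h₂ j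
        exact ⟨i, e.symm, ih i k⟩
      · obtain ⟨j, e, k⟩ := h₁ i
        exact ⟨j, e.symm, ih i k⟩

theorem PreBGO.Equiv.trans {x y z : PreBGO Act L} (h : PreBGO.Equiv x y)
    (k : PreBGO.Equiv y z) : PreBGO.Equiv x z := by
  induction x generalizing y z with
  | node l n a t ih =>
    cases y with
    | node l' n' a' t' =>
      cases z with
      | node l'' n'' a'' t'' =>
        obtain ⟨h₀, h₁, h₂⟩ := h
        obtain ⟨k₀, k₁, k₂⟩ := k
        refine ⟨h₀.trans k₀, fun i => ?_, fun m => ?_⟩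
        · obtain ⟨j, e, g⟩ := h₁ i
          obtain ⟨m, e', g'⟩ := k₁ j
          exact ⟨m, e.trans e', ih i g g'⟩
        · obtain ⟨j, e', g'⟩ := k₂ m
          obtain ⟨i, e, g⟩ := h₂ j
          exact ⟨i, e.trans e', ih i g g'⟩

instance PreBGO.setoid (Act : Type u) (L : Type v) : Setoid (PreBGO Act L) where
  r := PreBGO.Equiv
  iseqv := ⟨PreBGO.Equiv.refl, PreBGO.Equiv.symm, PreBGO.Equiv.trans⟩

/-- The branching general observations over the local observations `L`. -/
def BGO (Act : Type u) (L : Type v) : Type (max u v) := Quotient (PreBGO.setoid Act L)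

/-- The observation denoted by a presentation. -/
def BGO.mk (x : PreBGO Act L) : BGO Act L := Quotient.mk _ x

/-- A presentation of an observation. -/
noncomputable def BGO.out (o : BGO Act L) : PreBGO Act L := Quotient.out (s := PreBGO.setoid Act L) o

theorem BGO.mk_out (o : BGO Act L) : BGO.mk o.out = o :=
  Quotient.out_eq (s := PreBGO.setoid Act L) o

theorem BGO.mk_eq_mk {x y : PreBGO Act L} : BGO.mk x = BGO.mk y ↔ PreBGO.Equiv x y :=
  ⟨fun h => Quotient.exact (s := PreBGO.setoid Act L) h,
    fun h => Quotient.sound (s := PreBGO.setoid Act L) h⟩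

/-- The observation `⟨l, S⟩` with root `l` and finite set of children `S`. -/
noncomputable def BGO.node (l : L) (S : Finset (Act × BGO Act L)) : BGO Act L :=
  BGO.mk (PreBGO.node l S.card (fun i => (S.equivFin.symm i).1.1)
    (fun i => (S.equivFin.symm i).1.2.out))

/-- An observation is determined by its root label and its set of children, and conversely. -/
theorem BGO.node_inj {l l' : L} {S S' : Finset (Act × BGO Act L)} :
    BGO.node l S = BGO.node l' S' ↔ l = l' ∧ S = S' := by
  constructor
  · intro h
    obtain ⟨h₀, h₁, h₂⟩ := BGO.mk_eq_mk.1 h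
    refine ⟨h₀, Finset.Subset.antisymm (fun c hc => ?_) (fun c hc => ?_)⟩
    · obtain ⟨j, e, k⟩ := h₁ (S.equivFin ⟨c, hc⟩)
      have k' := BGO.mk_eq_mk.2 k
      simp only [Equiv.symm_apply_apply, BGO.mk_out] at e k'
      have : c = (S'.equivFin.symm j).1 := Prod.ext e k'
      rw [this]
      exact (S'.equivFin.symm j).2
    · obtain ⟨i, e, k⟩ := h₂ (S'.equivFin ⟨c, hc⟩)
      have k' := BGO.mk_eq_mk.2 k
      simp only [Equiv.symm_apply_apply, BGO.mk_out] at e k'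
      have : (S.equivFin.symm i).1 = c := Prod.ext e k'
      rw [← this]
      exact (S.equivFin.symm i).2
  · rintro ⟨rfl, rfl⟩
    rfl

/-- Every observation is built from local observations by finitely many applications of
`BGO.node`. -/
theorem BGO.induction {motive : BGO Act L → Prop}
    (h : ∀ (l : L) (S : Finset (Act × BGO Act L)), (∀ c ∈ S, motive c.2) → motive (BGO.node l S))
    (o : BGO Act L) : motive o := by
  classical
  suffices H : ∀ x : PreBGO Act L, motive (BGO.mk x) by
    have := H o.out
    rwa [BGO.mk_out] at this
  intro x
  induction x with
  | node l n a t ih =>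
    let f : Fin n → Act × BGO Act L := fun i => (a i, BGO.mk (t i))
    have key : BGO.mk (PreBGO.node l n a t) = BGO.node l (Finset.univ.image f) := by
      refine BGO.mk_eq_mk.2 ⟨rfl, fun i => ?_, fun j => ?_⟩
      · refine ⟨(Finset.univ.image f).equivFin ⟨f i, by simp⟩, ?_, BGO.mk_eq_mk.1 ?_⟩
        · simp [f]
        · simp [f, BGO.mk_out]
      · obtain ⟨i, -, hi⟩ := Finset.mem_image.1 ((Finset.univ.image f).equivFin.symm j).2
        refine ⟨i, congrArg Prod.fst hi, BGO.mk_eq_mk.1 ?_⟩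
        rw [BGO.mk_out]
        exact congrArg Prod.snd hi
    rw [key]
    refine h _ _ fun c hc => ?_
    obtain ⟨i, -, rfl⟩ := Finset.mem_image.1 hc
    exact ih i

/-- Deterministic observations: at every node, different children have different arcs. -/
inductive BGO.Deterministic : BGO Act L → Prop
  | node (l : L) (S : Finset (Act × BGO Act L)) :
      (∀ c ∈ S, ∀ d ∈ S, c.1 = d.1 → c = d) → (∀ c ∈ S, BGO.Deterministic c.2) →
      BGO.Deterministic (BGO.node l S)

variable {P : Type w}

/-- `IsBGO tr obs p o`: `o` is a branching general observation of `p` for the local observation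
function `obs`, i.e. `o = ⟨obs p, S⟩` with `S` a finite set of pairs `(a, o')` such that `o'` is
an observation of some `p'` with `p --a--> p'`. -/
inductive IsBGO (tr : P → Act → P → Prop) (obs : P → L) : P → BGO Act L → Prop
  | node (p : P) (S : Finset (Act × BGO Act L)) (p' : Act × BGO Act L → P) :
      (∀ c ∈ S, tr p c.1 (p' c)) → (∀ c ∈ S, IsBGO tr obs (p' c) c.2) →
      IsBGO tr obs p (BGO.node (obs p) S)

/-- The set `BGO_N(p)`. -/
def bgoSet (tr : P → Act → P → Prop) (obs : P → L) (p : P) : Set (BGO Act L) :=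
  {o | IsBGO tr obs p o}

/-- The set `dBGO_N(p)`. -/
def dbgoSet (tr : P → Act → P → Prop) (obs : P → L) (p : P) : Set (BGO Act L) :=
  bgoSet tr obs p ∩ {o | o.Deterministic}

/-! ### Linear general observations -/

/-- Linear general observations `X₀ a₁ X₁ … aₙ Xₙ`. -/
inductive LGO (Act : Type u) (L : Type v) : Type (max u v)
  | final (l : L) : LGO Act L
  | step (l : L) (a : Act) (o : LGO Act L) : LGO Act L

/-- `IsLGO tr obs p o`: `o` is a linear general observation of `p`. -/
inductive IsLGO (tr : P → Act → P → Prop) (obs : P → L) : P → LGO Act L → Prop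
  | final (p : P) : IsLGO tr obs p (LGO.final (obs p))
  | step {p p' : P} {a : Act} {o : LGO Act L} :
      tr p a p' → IsLGO tr obs p' o → IsLGO tr obs p (LGO.step (obs p) a o)

/-- The set `LGO_N(p)`. -/
def lgoSet (tr : P → Act → P → Prop) (obs : P → L) (p : P) : Set (LGO Act L) :=
  {o | IsLGO tr obs p o}

/-- Linear observations as degenerate branching observations. -/
noncomputable def LGO.toBGO : LGO Act L → BGO Act L
  | .final l => BGO.node l ∅
  | .step l a o => BGO.node l {(a, o.toBGO)}

/-- `LGO_N(p)` consists of the branching observations of `p` that are linear. -/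
theorem isLGO_iff_toBGO (tr : P → Act → P → Prop) (obs : P → L) (p : P) (o : LGO Act L) :
    IsLGO tr obs p o ↔ IsBGO tr obs p o.toBGO := by
  constructor
  · intro h
    induction h with
    | final p => exact IsBGO.node p ∅ (fun _ => p) (by simp) (by simp)
    | @step p p' a o h _ ih =>
      exact IsBGO.node p {(a, o.toBGO)} (fun _ => p') (by simpa using h) (by simpa using ih)
  · intro h
    induction o generalizing p with
    | final l =>
      generalize hx : LGO.toBGO (LGO.final (Act := Act) l) = x at h
      cases h with
      | node _ S p' h₁ h₂ =>
        obtain ⟨rfl, -⟩ := BGO.node_inj.1 hx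
        exact IsLGO.final p
    | step l a o ih =>
      generalize hx : LGO.toBGO (LGO.step l a o) = x at h
      cases h with
      | node _ S p' h₁ h₂ =>
        obtain ⟨rfl, rfl⟩ := BGO.node_inj.1 hx
        exact IsLGO.step (h₁ _ (Finset.mem_singleton_self _))
          (ih _ (h₂ _ (Finset.mem_singleton_self _)))

/-- `X₀a₁X₁…aₙXₙ` and `Y₀a₁Y₁…aₙYₙ` have the same actions and `r Xᵢ Yᵢ` for all `i ∈ 0..n`. -/
inductive LGO.Along (r : L → L → Prop) : LGO Act L → LGO Act L → Prop
  | final {l l' : L} : r l l' → LGO.Along r (.final l) (.final l')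
  | step {l l' : L} (a : Act) {o o' : LGO Act L} :
      r l l' → LGO.Along r o o' → LGO.Along r (.step l a o) (.step l' a o')

/-- `X₀a₁X₁…aₙXₙ` and `Y₀a₁Y₁…aₙYₙ` have the same actions and `r Xₙ Yₙ`. -/
inductive LGO.AtEnd (r : L → L → Prop) : LGO Act L → LGO Act L → Prop
  | final {l l' : L} : r l l' → LGO.AtEnd r (.final l) (.final l')
  | step (l l' : L) (a : Act) {o o' : LGO Act L} :
      LGO.AtEnd r o o' → LGO.AtEnd r (.step l a o) (.step l' a o')

/-- Every element of `A` is related to some element of `B`. -/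
def Dominated {X : Type w} (R : X → X → Prop) (A B : Set X) : Prop :=
  ∀ x ∈ A, ∃ y ∈ B, R x y

/-- The closure of `B`: all elements that are related to some element of `B`. -/
def closureBy {X : Type w} (R : X → X → Prop) (B : Set X) : Set X :=
  {x | ∃ y ∈ B, R x y}

end BGO

/-! ### Constraints, kinds of semantics and the observational preorders -/

/-- The constraints: universal, complete, initial offer, trace, simulation. -/
inductive Constraint
  | U | C | I | T | S

/-- The kinds of semantics at each layer. -/
inductive SemKind
  /-- `NS` -/
  | simulation
  /-- `≤_N^l` -/
  | readyTrace
  /-- `≤_N^{l⊇}` -/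
  | failureTrace
  /-- `≤_N^{lf}` -/
  | readiness
  /-- `≤_N^{lf⊇}` -/
  | failures
  /-- `≤_N^{l⊆}` -/
  | partialOfferTrace
  /-- `≤_N^{lf⊆}` -/
  | partialOffer
  /-- `D_N` -/
  | deterministic

section Observational

variable {Act : Type u} {P : Type v} {L : Type w}

/-- The observational preorder of kind `Y` for the local observation function `obs`, where `sup`
and `sub` are the relations written `⊇` and `⊆` on local observations. -/
def obsLEWith (tr : P → Act → P → Prop) (obs : P → L) (sup sub : L → L → Prop)
    (Y : SemKind) (p q : P) : Prop :=
  match Y with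
  | .simulation => bgoSet tr obs p ⊆ bgoSet tr obs q
  | .readyTrace => lgoSet tr obs p ⊆ lgoSet tr obs q
  | .failureTrace => Dominated (LGO.Along sup) (lgoSet tr obs p) (lgoSet tr obs q)
  | .readiness => Dominated (LGO.AtEnd Eq) (lgoSet tr obs p) (lgoSet tr obs q)
  | .failures => Dominated (LGO.AtEnd sup) (lgoSet tr obs p) (lgoSet tr obs q)
  | .partialOfferTrace => Dominated (LGO.Along sub) (lgoSet tr obs p) (lgoSet tr obs q)
  | .partialOffer => Dominated (LGO.AtEnd sub) (lgoSet tr obs p) (lgoSet tr obs q)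
  | .deterministic => dbgoSet tr obs p ⊆ dbgoSet tr obs q

/-- The presentation of the same preorders as inclusions between sets of observations, closed
under the relevant relation in the linear cases. -/
def obsInclWith (tr : P → Act → P → Prop) (obs : P → L) (sup sub : L → L → Prop)
    (Y : SemKind) (p q : P) : Prop :=
  match Y with
  | .simulation => bgoSet tr obs p ⊆ bgoSet tr obs q
  | .readyTrace => lgoSet tr obs p ⊆ lgoSet tr obs q
  | .failureTrace =>
      closureBy (LGO.Along sup) (lgoSet tr obs p) ⊆ closureBy (LGO.Along sup) (lgoSet tr obs q)
  | .readiness =>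
      closureBy (LGO.AtEnd Eq) (lgoSet tr obs p) ⊆ closureBy (LGO.AtEnd Eq) (lgoSet tr obs q)
  | .failures =>
      closureBy (LGO.AtEnd sup) (lgoSet tr obs p) ⊆ closureBy (LGO.AtEnd sup) (lgoSet tr obs q)
  | .partialOfferTrace =>
      closureBy (LGO.Along sub) (lgoSet tr obs p) ⊆ closureBy (LGO.Along sub) (lgoSet tr obs q)
  | .partialOffer =>
      closureBy (LGO.AtEnd sub) (lgoSet tr obs p) ⊆ closureBy (LGO.AtEnd sub) (lgoSet tr obs q)
  | .deterministic => dbgoSet tr obs p ⊆ dbgoSet tr obs q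

/-- The local observation for `C`: `true` iff the process is terminated. -/
noncomputable def terminated (tr : P → Act → P → Prop) (p : P) : Bool :=
  open Classical in decide (initials tr p = ∅)

/-- The relation `⊆` on local observations for `C`: if the second state is terminated then so is
the first one, that is, a state that can act is matched only by a state that can act. -/
def boolSub (b b' : Bool) : Prop := b' = true → b = true

/-- The observational preorder of kind `Y` at the layer `N`. The relation `⊇` is equality for
`U` and `C`, inclusion for `I` and `T`, and the simulation order on classes for `S`. -/
noncomputable def ObsLE (tr : P → Act → P → Prop) (N : Constraint) (Y : SemKind) (p q : P) :
    Prop :=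
  match N with
  | .U => obsLEWith tr (fun _ => ()) Eq Eq Y p q
  | .C => obsLEWith tr (terminated tr) Eq boolSub Y p q
  | .I => obsLEWith tr (initials tr) (fun X Z => Z ⊆ X) (fun X Z => X ⊆ Z) Y p q
  | .T => obsLEWith tr (traces tr) (fun X Z => Z ⊆ X) (fun X Z => X ⊆ Z) Y p q
  | .S => obsLEWith tr (Quotient.mk (simSetoid tr)) (fun X Z => simClassLE tr Z X)
      (fun X Z => simClassLE tr X Z) Y p q

/-- The observational preorder presented as inclusion of (closed) sets of observations. -/
noncomputable def ObsIncl (tr : P → Act → P → Prop) (N : Constraint) (Y : SemKind) (p q : P) :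
    Prop :=
  match N with
  | .U => obsInclWith tr (fun _ => ()) Eq Eq Y p q
  | .C => obsInclWith tr (terminated tr) Eq boolSub Y p q
  | .I => obsInclWith tr (initials tr) (fun X Z => Z ⊆ X) (fun X Z => X ⊆ Z) Y p q
  | .T => obsInclWith tr (traces tr) (fun X Z => Z ⊆ X) (fun X Z => X ⊆ Z) Y p q
  | .S => obsInclWith tr (Quotient.mk (simSetoid tr)) (fun X Z => simClassLE tr Z X)
      (fun X Z => simClassLE tr X Z) Y p q

end Observational

/-! ### Hennessy-Milner logic and its sublogics -/

section Logic

variable {Act : Type u} {P : Type v}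

/-- Hennessy-Milner formulas, with conjunctions over arbitrary index types. -/
inductive HML (Act : Type u) : Type (u + 1)
  | conj {ι : Type u} (φ : ι → HML Act) : HML Act
  | dia (a : Act) (φ : HML Act) : HML Act
  | neg (φ : HML Act) : HML Act

/-- The satisfaction relation. -/
def HML.Sat (tr : P → Act → P → Prop) : HML Act → P → Prop
  | .conj φ, p => ∀ i, HML.Sat tr (φ i) p
  | .dia a φ, p => ∃ q, tr p a q ∧ HML.Sat tr φ q
  | .neg φ, p => ¬ HML.Sat tr φ p

/-- `⊤`, the empty conjunction. -/
def HML.top : HML Act := .conj (ι := PEmpty) (fun i => i.elim)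

/-- Binary conjunction. -/
def HML.and (φ ψ : HML Act) : HML Act :=
  .conj (ι := ULift Bool) (fun i => if i.down then φ else ψ)

/-- `0 = ⋀_{a ∈ Act} ¬ a⊤`. -/
def HML.zero : HML Act := .conj (fun a : Act => .neg (.dia a .top))

/-- `¬ 0`. -/
def HML.nonzero : HML Act := .neg .zero

/-- The finitary formulas, all of whose conjunctions are finite. -/
inductive HML.Finitary : HML Act → Prop
  | conj {ι : Type u} (φ : ι → HML Act) :
      Finite ι → (∀ i, HML.Finitary (φ i)) → HML.Finitary (.conj φ)
  | dia (a : Act) (φ : HML Act) : HML.Finitary φ → HML.Finitary (.dia a φ)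
  | neg (φ : HML Act) : HML.Finitary φ → HML.Finitary (.neg φ)

/-- The preorder induced by a set of formulas. -/
def LogicLE (tr : P → Act → P → Prop) (K : Set (HML Act)) (p q : P) : Prop :=
  ∀ φ ∈ K, HML.Sat tr φ p → HML.Sat tr φ q

/-- The symmetric closure of a set of formulas. -/
inductive SymClosure (K : Set (HML Act)) : HML Act → Prop
  | pos (σ : HML Act) : σ ∈ K → SymClosure K σ
  | neg (σ : HML Act) : σ ∈ K → SymClosure K (.neg σ)
  | conj {ι : Type u} (σ : ι → HML Act) : (∀ i, SymClosure K (σ i)) → SymClosure K (.conj σ)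

/-- The negative closure of a set of formulas. -/
inductive NegClosure (K : Set (HML Act)) : HML Act → Prop
  | neg (σ : HML Act) : σ ∈ K → NegClosure K (.neg σ)
  | conj {ι : Type u} (σ : ι → HML Act) : (∀ i, NegClosure K (σ i)) → NegClosure K (.conj σ)

/-- The positive closure of a set of formulas. -/
inductive PosClosure (K : Set (HML Act)) : HML Act → Prop
  | pos (σ : HML Act) : σ ∈ K → PosClosure K σ
  | conj {ι : Type u} (σ : ι → HML Act) : (∀ i, PosClosure K (σ i)) → PosClosure K (.conj σ)

/-- The formulas for the `N`-constrained simulation, from a set `K` of formulas for `N`. -/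
inductive SimLogic (K : Set (HML Act)) : HML Act → Prop
  | pos (σ : HML Act) : σ ∈ K → SimLogic K σ
  | neg (σ : HML Act) : σ ∈ K → SimLogic K (.neg σ)
  | conj {ι : Type u} (φ : ι → HML Act) : (∀ i, SimLogic K (φ i)) → SimLogic K (.conj φ)
  | dia (a : Act) (φ : HML Act) : SimLogic K φ → SimLogic K (.dia a φ)

/-- Linear formulas with local formulas from `Q` all along the computation. -/
inductive AlongLogic (Q : HML Act → Prop) : HML Act → Prop
  | top : AlongLogic Q .top
  | and (σ φ : HML Act) : Q σ → AlongLogic Q φ → AlongLogic Q (.and σ φ)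
  | dia (a : Act) (φ : HML Act) : AlongLogic Q φ → AlongLogic Q (.dia a φ)

/-- Linear formulas with a local formula from `Q` at the end of the computation. -/
inductive AtEndLogic (Q : HML Act → Prop) : HML Act → Prop
  | top : AtEndLogic Q .top
  | loc (σ : HML Act) : Q σ → AtEndLogic Q σ
  | dia (a : Act) (φ : HML Act) : AtEndLogic Q φ → AtEndLogic Q (.dia a φ)

/-- Deterministic branching formulas with local formulas from `Q`. -/
inductive DetLogic (Q : HML Act → Prop) : HML Act → Prop
  | top : DetLogic Q .top
  | and (σ φ : HML Act) : Q σ → DetLogic Q φ → DetLogic Q (.and σ φ)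
  | branch (X : Set Act) (φ : X → HML Act) :
      (∀ a, DetLogic Q (φ a)) → DetLogic Q (.conj (fun a : X => .dia a.1 (φ a)))

/-- Trace formulas. -/
inductive TraceLogic : HML Act → Prop
  | top : TraceLogic .top
  | dia (a : Act) (φ : HML Act) : TraceLogic φ → TraceLogic (.dia a φ)

/-- The logics `L'_N` of the constraints. -/
def constraintLogic : Constraint → Set (HML Act)
  | .U => {HML.top}
  | .C => {HML.top, HML.nonzero}
  | .I => {HML.top, HML.nonzero} ∪ {φ | ∃ a, φ = HML.dia a HML.top}
  | .T => {φ | TraceLogic φ}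
  | .S => {φ | SimLogic {HML.top} φ}

/-- The unified logics `L'_{Y_N}`. -/
def unifiedLogic (N : Constraint) : SemKind → Set (HML Act)
  | .simulation => {φ | SimLogic (constraintLogic N) φ}
  | .readyTrace => {φ | AlongLogic (SymClosure (constraintLogic N)) φ}
  | .failureTrace => {φ | AlongLogic (NegClosure (constraintLogic N)) φ}
  | .readiness => {φ | AtEndLogic (SymClosure (constraintLogic N)) φ}
  | .failures => {φ | AtEndLogic (NegClosure (constraintLogic N)) φ}
  | .partialOfferTrace => {φ | AlongLogic (PosClosure (constraintLogic N)) φ}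
  | .partialOffer => {φ | AtEndLogic (PosClosure (constraintLogic N)) φ}
  | .deterministic => {φ | DetLogic (SymClosure (constraintLogic N)) φ}

/-- The finitary fragments `L^f_{Y_N} = L'_{Y_N} ∩ L^f_HM`. -/
def finitaryLogic (N : Constraint) (Y : SemKind) : Set (HML Act) :=
  unifiedLogic N Y ∩ {φ | φ.Finitary}

end Logic

/-! ### Image-finiteness and classes of formulas closed under finite conjunctions -/

section Basics

variable {Act : Type u} {P : Type v} {tr : P → Act → P → Prop}

/-! The theorem reduces to two facts about formulas and observations, proved once for an abstract
local observation `obs` and then applied to the five constraints.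

From logic to observations, every observation of `p` has a finite description relative to a finite
set `Q` of competitors: a formula of the logic, true at `p`, whose models in `Q` have that
observation or one suitably related to it. A local observation need not be definable by one formula,
but it can be separated from finitely many others by a finite conjunction (`Characterises`).
Induction on the observation replaces `Q` by its `a`-successors, which are finitely many by
image-finiteness; at the end `Q` is `{q}`. Only finite conjunctions are formed, apart from the
formula `HML.nonzero` needed for `C`. A parameter `F` on formulas therefore settles the full logic
(`F` always true) and the finitary fragment (`F` is `HML.Finitary`) together.

From observations to logic, a linear formula true at `p` is already forced by one observation
(`AlongLogic.exists_lgo`, `AtEndLogic.exists_lgo`). For simulations, finitely many observations of a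
state merge into one, so inclusion of observations is inherited by suitable successors
(`exists_succ_bgoSet_subset`). Deterministic trees cannot be merged in this way, and a formula is
instead forced by a directed set of them (`DetLogic.exists_directed`).

The irregular case is `C`, where `⊇` is equality although negative formulas express only one
direction of it; `ExpressesSup` isolates this. -/

theorem ImageFinite.step {p p' : P} {a : Act} (hp : ImageFinite tr p) (h : tr p a p') :
    ImageFinite tr p' :=
  fun α _ hs b => hp (a :: α) _ (Steps.cons h hs) b

theorem ImageFinite.finite_succ {p : P} (hp : ImageFinite tr p) (a : Act) :
    {p' | tr p a p'}.Finite :=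
  hp [] p (Steps.nil p) a

/-- The `a`-successors of a set of states. -/
def successors (tr : P → Act → P → Prop) (Q : Set P) (a : Act) : Set P :=
  {q' | ∃ q ∈ Q, tr q a q'}

theorem finite_successors {Q : Set P} (hQ : Q.Finite) (hI : ∀ q ∈ Q, ImageFinite tr q) (a : Act) :
    (successors tr Q a).Finite := by
  have h : successors tr Q a = ⋃ q ∈ Q, {q' | tr q a q'} := by
    ext; simp [successors]
  rw [h]
  exact hQ.biUnion fun q hq => (hI q hq).finite_succ a

theorem imageFinite_of_mem_successors {Q : Set P} (hI : ∀ q ∈ Q, ImageFinite tr q) (a : Act) :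
    ∀ q ∈ successors tr Q a, ImageFinite tr q := by
  rintro q' ⟨q, hq, h⟩
  exact (hI q hq).step h

theorem HML.sat_top (p : P) : HML.Sat tr HML.top p := fun i => i.elim

theorem HML.sat_and {φ ψ : HML Act} {p : P} :
    HML.Sat tr (φ.and ψ) p ↔ HML.Sat tr φ p ∧ HML.Sat tr ψ p := by
  constructor
  · intro h
    exact ⟨by simpa using h ⟨true⟩, by simpa using h ⟨false⟩⟩
  · rintro ⟨h₁, h₂⟩ ⟨i⟩
    cases i <;> simpa

theorem HML.sat_nonzero {p : P} :
    HML.Sat tr HML.nonzero p ↔ ∃ a p', tr p a p' := by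
  simp only [HML.nonzero, HML.zero, HML.Sat, HML.sat_top, and_true]
  push Not
  rfl

/-- Classes of formulas closed under finite conjunctions. -/
def ConjClosed (G : HML Act → Prop) : Prop :=
  ∀ (ι : Type u) (φ : ι → HML Act), Finite ι → (∀ i, G (φ i)) → G (.conj φ)

theorem ConjClosed.top {G : HML Act → Prop} (hG : ConjClosed G) : G HML.top :=
  hG _ _ inferInstance fun i => i.elim

theorem ConjClosed.and {G : HML Act → Prop} (hG : ConjClosed G) {φ ψ : HML Act}
    (hφ : G φ) (hψ : G ψ) : G (φ.and ψ) :=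
  hG _ _ inferInstance fun i => by by_cases h : i.down <;> simp [h, hφ, hψ]

theorem ConjClosed.inf {G H : HML Act → Prop} (hG : ConjClosed G) (hH : ConjClosed H) :
    ConjClosed fun φ => G φ ∧ H φ :=
  fun ι φ hι h => ⟨hG ι φ hι fun i => (h i).1, hH ι φ hι fun i => (h i).2⟩

/-- Finitely many formulas true at `p` have a conjunction in the class. -/
theorem ConjClosed.exists_forall {G : HML Act → Prop} (hG : ConjClosed G) {X : Type w}
    {s : Set X} (hs : s.Finite) (p : P) {C : X → P → Prop}
    (h : ∀ x ∈ s, ∃ φ, G φ ∧ HML.Sat tr φ p ∧ ∀ q, HML.Sat tr φ q → C x q) :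
    ∃ φ, G φ ∧ HML.Sat tr φ p ∧ ∀ q, HML.Sat tr φ q → ∀ x ∈ s, C x q := by
  induction s, hs using Set.Finite.induction_on with
  | empty => exact ⟨HML.top, hG.top, HML.sat_top p, by simp⟩
  | @insert x s _ _ ih =>
    obtain ⟨φ, hφ, hφp, hφq⟩ := ih fun y hy => h y (Set.mem_insert_of_mem _ hy)
    obtain ⟨ψ, hψ, hψp, hψq⟩ := h x (Set.mem_insert _ _)
    refine ⟨ψ.and φ, hG.and hψ hφ, HML.sat_and.2 ⟨hψp, hφp⟩, fun q hq y hy => ?_⟩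
    obtain ⟨h₁, h₂⟩ := HML.sat_and.1 hq
    rcases hy with rfl | hy
    · exact hψq q h₁
    · exact hφq q h₂ y hy

/-- Classes of formulas closed under finite conjunctions, prefixes and negations. -/
structure FinitelyClosed (F : HML Act → Prop) : Prop where
  conj : ConjClosed F
  dia : ∀ (a : Act) {φ : HML Act}, F φ → F (.dia a φ)
  neg : ∀ {φ : HML Act}, F φ → F (.neg φ)

theorem finitelyClosed_true : FinitelyClosed (fun _ : HML Act => True) :=
  ⟨fun _ _ _ _ => trivial, fun _ _ _ => trivial, fun _ => trivial⟩

theorem finitelyClosed_finitary : FinitelyClosed (HML.Finitary (Act := Act)) :=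
  ⟨fun _ φ hι h => .conj φ hι h, fun a _ h => .dia a _ h, fun h => .neg _ h⟩

theorem symClosure_conjClosed (K : Set (HML Act)) : ConjClosed (SymClosure K) :=
  fun _ φ _ h => .conj φ h

theorem negClosure_conjClosed (K : Set (HML Act)) : ConjClosed (NegClosure K) :=
  fun _ φ _ h => .conj φ h

theorem posClosure_conjClosed (K : Set (HML Act)) : ConjClosed (PosClosure K) :=
  fun _ φ _ h => .conj φ h

theorem simLogic_conjClosed (K : Set (HML Act)) : ConjClosed (SimLogic K) :=
  fun _ φ _ h => .conj φ h

end Basics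

/-! ### Local observations and the formulas that express them -/

section Local

variable {Act : Type u} {P : Type v} {L : Type w} {tr : P → Act → P → Prop}

/-- The formulas of `K` express the preorder `sub` on the local observations `obs`, and on
image-finite states the formulas of `K` that belong to `F` suffice. -/
structure Expresses (tr : P → Act → P → Prop) (obs : P → L) (sub : L → L → Prop)
    (K : Set (HML Act)) (F : HML Act → Prop) : Prop where
  refl : ∀ x, sub x x
  trans : ∀ x y z, sub x y → sub y z → sub x z
  antisymm : ∀ x y, sub x y → sub y x → x = y
  sound : ∀ p q, sub (obs p) (obs q) → ∀ σ ∈ K, HML.Sat tr σ p → HML.Sat tr σ q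
  separates : ∀ p q, ImageFinite tr p → ImageFinite tr q → ¬ sub (obs p) (obs q) →
    ∃ σ ∈ K, F σ ∧ HML.Sat tr σ p ∧ ¬ HML.Sat tr σ q

variable {obs : P → L} {sub : L → L → Prop} {K : Set (HML Act)} {F : HML Act → Prop}

theorem Expresses.sound_posClosure (E : Expresses tr obs sub K F) {p q : P} {σ : HML Act}
    (h : sub (obs p) (obs q)) (hσ : PosClosure K σ) (hp : HML.Sat tr σ p) :
    HML.Sat tr σ q := by
  induction hσ with
  | pos σ hσ => exact E.sound p q h σ hσ hp
  | conj σ _ ih => exact fun i => ih i (hp i)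

theorem Expresses.sound_negClosure (E : Expresses tr obs sub K F) {p q : P} {σ : HML Act}
    (h : sub (obs q) (obs p)) (hσ : NegClosure K σ) (hp : HML.Sat tr σ p) :
    HML.Sat tr σ q := by
  induction hσ with
  | neg σ hσ => exact fun hq => hp (E.sound q p h σ hσ hq)
  | conj σ _ ih => exact fun i => ih i (hp i)

theorem Expresses.sound_symClosure (E : Expresses tr obs sub K F) {p q : P} {σ : HML Act}
    (h : obs p = obs q) (hσ : SymClosure K σ) (hp : HML.Sat tr σ p) :
    HML.Sat tr σ q := by
  induction hσ with
  | pos σ hσ => exact E.sound p q (h ▸ E.refl _) σ hσ hp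
  | neg σ hσ => exact fun hq => hp (E.sound q p (h ▸ E.refl _) σ hσ hq)
  | conj σ _ ih => exact fun i => ih i (hp i)

/-- A class of formulas that characterises, relative to any finite set of image-finite states,
the states whose observation is `r`-related to that of a given image-finite state. -/
def Characterises (tr : P → Act → P → Prop) (obs : P → L) (r : L → L → Prop)
    (G : HML Act → Prop) : Prop :=
  ∀ (p : P) (Q : Set P), ImageFinite tr p → Q.Finite → (∀ q ∈ Q, ImageFinite tr q) →
    ∃ σ, G σ ∧ HML.Sat tr σ p ∧ ∀ q ∈ Q, HML.Sat tr σ q → r (obs p) (obs q)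

theorem characterises_of_separates {r : L → L → Prop} {G : HML Act → Prop} (hG : ConjClosed G)
    (h : ∀ p q, ImageFinite tr p → ImageFinite tr q → ¬ r (obs p) (obs q) →
      ∃ σ, G σ ∧ HML.Sat tr σ p ∧ ¬ HML.Sat tr σ q) :
    Characterises tr obs r G := by
  intro p Q hp hQ hI
  obtain ⟨σ, h₁, h₂, h₃⟩ := hG.exists_forall (tr := tr) hQ p
    -- One conjunct per state `x` of `Q` is responsible for excluding `x` alone; at the end `x` is
    -- taken to be the model itself.
    (C := fun x q => q = x → r (obs p) (obs q)) (by
      intro q hq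
      by_cases hr : r (obs p) (obs q)
      · exact ⟨HML.top, hG.top, HML.sat_top p, by rintro _ - rfl; exact hr⟩
      · obtain ⟨σ, h₁, h₂, h₃⟩ := h p q hp (hI q hq) hr
        exact ⟨σ, h₁, h₂, by rintro _ h rfl; exact absurd h h₃⟩)
  exact ⟨σ, h₁, h₂, fun q hq hs => h₃ q hs q hq rfl⟩

theorem Characterises.mono {r : L → L → Prop} {G H : HML Act → Prop}
    (h : Characterises tr obs r G) (hGH : ∀ σ, G σ → H σ) : Characterises tr obs r H := by
  intro p Q hp hQ hI
  obtain ⟨σ, h₁, h₂, h₃⟩ := h p Q hp hQ hI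
  exact ⟨σ, hGH σ h₁, h₂, h₃⟩

theorem Expresses.characterises_pos (E : Expresses tr obs sub K F) (hF : FinitelyClosed F) :
    Characterises tr obs sub fun σ => PosClosure K σ ∧ F σ := by
  refine characterises_of_separates ((posClosure_conjClosed K).inf hF.conj) fun p q hp hq h => ?_
  obtain ⟨σ, h₁, h₂, h₃, h₄⟩ := E.separates p q hp hq h
  exact ⟨σ, ⟨.pos σ h₁, h₂⟩, h₃, h₄⟩

theorem Expresses.characterises_neg (E : Expresses tr obs sub K F) (hF : FinitelyClosed F) :
    Characterises tr obs (fun x y => sub y x) fun σ => NegClosure K σ ∧ F σ := by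
  refine characterises_of_separates ((negClosure_conjClosed K).inf hF.conj) fun p q hp hq h => ?_
  obtain ⟨σ, h₁, h₂, h₃, h₄⟩ := E.separates q p hq hp h
  exact ⟨.neg σ, ⟨.neg σ h₁, hF.neg h₂⟩, h₄, fun h => h h₃⟩

/-- By antisymmetry, distinct observations fail to be ordered in at least one direction; a
separating formula is used as it stands in one case and negated in the other. -/
theorem Expresses.characterises_sym (E : Expresses tr obs sub K F) (hF : FinitelyClosed F) :
    Characterises tr obs Eq fun σ => SymClosure K σ ∧ F σ := by
  refine characterises_of_separates ((symClosure_conjClosed K).inf hF.conj) fun p q hp hq h => ?_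
  by_cases hpq : sub (obs p) (obs q)
  · obtain ⟨σ, h₁, h₂, h₃, h₄⟩ := E.separates q p hq hp fun hqp => h (E.antisymm _ _ hpq hqp)
    exact ⟨.neg σ, ⟨.neg σ h₁, hF.neg h₂⟩, h₄, fun h => h h₃⟩
  · obtain ⟨σ, h₁, h₂, h₃, h₄⟩ := E.separates p q hp hq hpq
    exact ⟨σ, ⟨.pos σ h₁, h₂⟩, h₃, h₄⟩

end Local

/-! ### The five constraints -/

section Constraints

variable {Act : Type u} {P : Type v} {tr : P → Act → P → Prop} {F : HML Act → Prop}

theorem expresses_universal :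
    Expresses tr (fun _ : P => ()) Eq (constraintLogic .U) F where
  refl _ := rfl
  trans _ _ _ := Eq.trans
  antisymm _ _ h _ := h
  sound p q _ σ hσ _ := by
    obtain rfl : σ = HML.top := hσ
    exact HML.sat_top q
  separates p q _ _ h := absurd rfl h

theorem terminated_eq_true {p : P} : terminated tr p = true ↔ ¬ ∃ a p', tr p a p' := by
  rw [terminated, decide_eq_true_iff, Set.eq_empty_iff_forall_notMem]
  simp [initials]

/-- The separating formula here contains a conjunction over all of `Act`, so its membership in `F`
must be assumed. This is the source of the finiteness condition on `Act`. -/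
theorem expresses_complete (hF : F HML.nonzero) :
    Expresses tr (terminated tr) boolSub (constraintLogic .C) F where
  refl _ := id
  trans _ _ _ h k := h ∘ k
  antisymm x y h k := by cases x <;> cases y <;> simp_all [boolSub]
  sound p q h σ hσ hp := by
    rcases hσ with rfl | hσ
    · exact HML.sat_top q
    · obtain rfl : σ = HML.nonzero := hσ
      rw [HML.sat_nonzero] at hp ⊢
      by_contra hq
      exact terminated_eq_true.1 (h (terminated_eq_true.2 hq)) hp
  separates p q _ _ h := by
    rw [boolSub, terminated_eq_true, terminated_eq_true, Classical.not_imp, not_not] at h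
    exact ⟨HML.nonzero, Or.inr rfl, hF, HML.sat_nonzero.2 h.2, fun k => h.1 (HML.sat_nonzero.1 k)⟩

/-- Separation uses only the formulas `a⊤`, never `HML.nonzero`, so no condition on `Act` arises. -/
theorem expresses_initials (hF : FinitelyClosed F) :
    Expresses tr (initials tr) (fun X Z => X ⊆ Z) (constraintLogic .I) F where
  refl _ := subset_rfl
  trans _ _ _ := Set.Subset.trans
  antisymm _ _ := Set.Subset.antisymm
  sound p q h σ hσ hp := by
    rcases hσ with (rfl | hσ) | ⟨a, rfl⟩
    · exact HML.sat_top q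
    · obtain rfl : σ = HML.nonzero := hσ
      rw [HML.sat_nonzero] at hp ⊢
      obtain ⟨a, hp⟩ := hp
      exact ⟨a, h hp⟩
    · obtain ⟨p', hp', -⟩ := hp
      obtain ⟨q', hq'⟩ := h ⟨p', hp'⟩
      exact ⟨q', hq', HML.sat_top q'⟩
  separates p q _ _ h := by
    obtain ⟨a, ⟨p', hp⟩, hq⟩ := Set.not_subset.1 h
    exact ⟨.dia a .top, Or.inr ⟨a, rfl⟩, hF.dia a hF.conj.top, ⟨p', hp, HML.sat_top p'⟩,
      fun ⟨q', hq', _⟩ => hq ⟨q', hq'⟩⟩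

theorem TraceLogic.exists_trace {σ : HML Act} (hσ : TraceLogic σ) :
    ∃ α : List Act, ∀ p : P, HML.Sat tr σ p ↔ α ∈ traces tr p := by
  induction hσ with
  | top => exact ⟨[], fun p => ⟨fun _ => ⟨p, .nil p⟩, fun _ => HML.sat_top p⟩⟩
  | dia a φ _ ih =>
    obtain ⟨α, hα⟩ := ih
    refine ⟨a :: α, fun p => ⟨?_, ?_⟩⟩
    · rintro ⟨p', h, hs⟩
      obtain ⟨p'', hp''⟩ := (hα p').1 hs
      exact ⟨p'', .cons h hp''⟩
    · rintro ⟨p'', _ | ⟨h, hs⟩⟩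
      exact ⟨_, h, (hα _).2 ⟨p'', hs⟩⟩

theorem exists_traceLogic (hF : FinitelyClosed F) (α : List Act) :
    ∃ σ, TraceLogic σ ∧ F σ ∧ ∀ p : P, HML.Sat tr σ p ↔ α ∈ traces tr p := by
  induction α with
  | nil => exact ⟨.top, .top, hF.conj.top, fun p => ⟨fun _ => ⟨p, .nil p⟩, fun _ => HML.sat_top p⟩⟩
  | cons a α ih =>
    obtain ⟨σ, h₁, h₂, hα⟩ := ih
    refine ⟨.dia a σ, .dia a σ h₁, hF.dia a h₂, fun p => ⟨?_, ?_⟩⟩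
    · rintro ⟨p', h, hs⟩
      obtain ⟨p'', hp''⟩ := (hα p').1 hs
      exact ⟨p'', .cons h hp''⟩
    · rintro ⟨p'', _ | ⟨h, hs⟩⟩
      exact ⟨_, h, (hα _).2 ⟨p'', hs⟩⟩

theorem expresses_traces (hF : FinitelyClosed F) :
    Expresses tr (traces tr) (fun X Z => X ⊆ Z) (constraintLogic .T) F where
  refl _ := subset_rfl
  trans _ _ _ := Set.Subset.trans
  antisymm _ _ := Set.Subset.antisymm
  sound p q h σ hσ hp := by
    obtain ⟨α, hα⟩ := TraceLogic.exists_trace (tr := tr) hσ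
    exact (hα q).2 (h ((hα p).1 hp))
  separates p q _ _ h := by
    obtain ⟨α, hp, hq⟩ := Set.not_subset.1 h
    obtain ⟨σ, h₁, h₂, hα⟩ := exists_traceLogic (tr := tr) hF α
    exact ⟨σ, h₁, h₂, (hα p).2 hp, fun k => hq ((hα q).1 k)⟩

theorem SimLE.sat {p q : P} (h : SimLE tr p q) {φ : HML Act} (hφ : SimLogic {HML.top} φ)
    (hp : HML.Sat tr φ p) : HML.Sat tr φ q := by
  obtain ⟨R, hR, hpq⟩ := h
  induction hφ generalizing p q with
  | pos σ hσ =>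
    obtain rfl : σ = HML.top := hσ
    exact HML.sat_top q
  | neg σ hσ =>
    -- The only negation available is `¬⊤`, which no state satisfies; the logic is therefore
    -- effectively positive.
    obtain rfl : σ = HML.top := hσ
    exact absurd (HML.sat_top p) hp
  | conj φ _ ih => exact fun i => ih i (hp i) hpq
  | dia a φ _ ih =>
    obtain ⟨p', h, hs⟩ := hp
    obtain ⟨q', hq, hR'⟩ := hR p q hpq a p' h
    exact ⟨q', hq, ih hs hR'⟩

/-- The Hennessy–Milner argument: preservation of formulas is itself a simulation. If no
`a`-successor of `q` matched `p'`, the conjunction of finitely many separating formulas, prefixed by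
`a`, would hold at `p` but not at `q`. Only the right-hand state must be image-finite. -/
theorem simLE_of_sat (hF : FinitelyClosed F) {p q : P} (hq : ImageFinite tr q)
    (h : ∀ φ, SimLogic {HML.top} φ → F φ → HML.Sat tr φ p → HML.Sat tr φ q) : SimLE tr p q := by
  refine ⟨fun p q => ImageFinite tr q ∧
    ∀ φ, SimLogic {HML.top} φ → F φ → HML.Sat tr φ p → HML.Sat tr φ q, ?_, hq, h⟩
  rintro p q ⟨hq, h⟩ a p' hp'
  by_contra hcon
  push Not at hcon
  obtain ⟨φ, ⟨h₁, h₂⟩, h₃, h₄⟩ :=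
    ((simLogic_conjClosed {HML.top}).inf hF.conj).exists_forall (tr := tr) (hq.finite_succ a) p'
    (C := fun x r => r ≠ x) (by
      intro q' hq'
      obtain ⟨φ, h₁, h₂, h₃, h₄⟩ := hcon q' hq' (hq.step hq')
      exact ⟨φ, ⟨h₁, h₂⟩, h₃, by rintro _ h rfl; exact h₄ h⟩)
  obtain ⟨q', hq', hs⟩ := h _ (.dia a φ h₁) (hF.dia a h₂) ⟨p', hp', h₃⟩
  exact h₄ q' hs q' hq' rfl

theorem expresses_simulation (hF : FinitelyClosed F) :
    Expresses tr (Quotient.mk (simSetoid tr)) (fun X Z => simClassLE tr X Z)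
      (constraintLogic .S) F where
  refl x := by
    induction x using Quotient.inductionOn
    exact SimLE.refl tr _
  trans x y z := by
    induction x using Quotient.inductionOn
    induction y using Quotient.inductionOn
    induction z using Quotient.inductionOn
    exact SimLE.trans
  antisymm x y := by
    induction x using Quotient.inductionOn
    induction y using Quotient.inductionOn
    exact fun h k => Quotient.sound ⟨h, k⟩
  sound p q h σ hσ hp := SimLE.sat h hσ hp
  separates p q _ hq h := by
    by_contra hcon
    push Not at hcon
    exact h (simLE_of_sat hF hq fun φ h₁ h₂ h₃ => hcon φ h₁ h₂ h₃)

end Constraints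

/-! ### Linear observations -/

section Linear

variable {Act : Type u} {P : Type v} {L : Type w} {tr : P → Act → P → Prop} {obs : P → L}
  {r : L → L → Prop} {G F : HML Act → Prop}

/-- The first local observation of a linear observation. -/
def LGO.root : LGO Act L → L
  | .final l => l
  | .step l _ _ => l

theorem IsLGO.root_eq {p : P} {o : LGO Act L} (h : IsLGO tr obs p o) : o.root = obs p := by
  cases h <;> rfl

theorem LGO.Along.root {o o' : LGO Act L} (h : LGO.Along r o o') : r o.root o'.root := by
  cases h <;> assumption

theorem LGO.along_eq_iff {o o' : LGO Act L} : LGO.Along Eq o o' ↔ o = o' := by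
  constructor
  · intro h
    induction h with
    | final h => rw [h]
    | step a h _ ih => rw [h, ih]
  · rintro rfl
    induction o with
    | final l => exact .final rfl
    | step l a o ih => exact .step a rfl ih

theorem LGO.Along.refl (hr : ∀ x, r x x) (o : LGO Act L) : LGO.Along r o o := by
  induction o with
  | final l => exact .final (hr l)
  | step l a o ih => exact .step a (hr l) ih

theorem LGO.Along.trans (hr : ∀ x y z, r x y → r y z → r x z) {o₁ o₂ o₃ : LGO Act L}
    (h : LGO.Along r o₁ o₂) (k : LGO.Along r o₂ o₃) : LGO.Along r o₁ o₃ := by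
  induction h generalizing o₃ with
  | final h =>
    cases k with
    | final k => exact .final (hr _ _ _ h k)
  | step a h _ ih =>
    cases k with
    | step _ k k' => exact .step a (hr _ _ _ h k) (ih k')

theorem LGO.AtEnd.refl (hr : ∀ x, r x x) (o : LGO Act L) : LGO.AtEnd r o o := by
  induction o with
  | final l => exact .final (hr l)
  | step l a o ih => exact .step l l a ih

theorem LGO.AtEnd.trans (hr : ∀ x y z, r x y → r y z → r x z) {o₁ o₂ o₃ : LGO Act L}
    (h : LGO.AtEnd r o₁ o₂) (k : LGO.AtEnd r o₂ o₃) : LGO.AtEnd r o₁ o₃ := by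
  induction h generalizing o₃ with
  | final h =>
    cases k with
    | final k => exact .final (hr _ _ _ h k)
  | step l l' a _ ih =>
    cases k with
    | step _ l'' _ k => exact .step l l'' a (ih k)

theorem dominated_iff_closureBy_subset {X : Type w} {R : X → X → Prop} (hR : ∀ x, R x x)
    (hR' : ∀ {x y z}, R x y → R y z → R x z) {A B : Set X} :
    Dominated R A B ↔ closureBy R A ⊆ closureBy R B := by
  constructor
  · rintro h x ⟨y, hy, hxy⟩
    obtain ⟨z, hz, hyz⟩ := h y hy
    exact ⟨z, hz, hR' hxy hyz⟩
  · exact fun h x hx => h ⟨x, hx, hR x⟩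

/-- A linear formula true at `p` is forced by a single linear observation of `p`. -/
theorem AlongLogic.exists_lgo
    (hG : ∀ {p q σ}, r (obs p) (obs q) → G σ → HML.Sat tr σ p → HML.Sat tr σ q)
    {φ : HML Act} (hφ : AlongLogic G φ) {p : P} (hp : HML.Sat tr φ p) :
    ∃ o, IsLGO tr obs p o ∧
      ∀ q o', LGO.Along r o o' → IsLGO tr obs q o' → HML.Sat tr φ q := by
  induction hφ generalizing p with
  | top => exact ⟨_, .final p, fun q _ _ _ => HML.sat_top q⟩
  | and σ φ hσ _ ih =>
    obtain ⟨h₁, h₂⟩ := HML.sat_and.1 hp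
    obtain ⟨o, ho, hq⟩ := ih h₂
    -- The new conjunct speaks only of the present state, which the root of `o` already records, so
    -- the observation needs no extension.
    refine ⟨o, ho, fun q o' hoo' ho' => HML.sat_and.2 ⟨hG ?_ hσ h₁, hq q o' hoo' ho'⟩⟩
    rw [← ho.root_eq, ← ho'.root_eq]
    exact hoo'.root
  | dia a φ _ ih =>
    obtain ⟨p', h, hs⟩ := hp
    obtain ⟨o, ho, hq⟩ := ih hs
    refine ⟨_, .step h ho, ?_⟩
    rintro q _ (_ | ⟨_, _, k⟩) (_ | ⟨hq', ho'⟩)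
    exact ⟨_, hq', hq _ _ k ho'⟩

theorem logicLE_of_dominated_along
    (hG : ∀ {p q σ}, r (obs p) (obs q) → G σ → HML.Sat tr σ p → HML.Sat tr σ q) {p q : P}
    (h : Dominated (LGO.Along r) (lgoSet tr obs p) (lgoSet tr obs q)) :
    LogicLE tr {φ | AlongLogic G φ} p q := by
  intro φ hφ hp
  obtain ⟨o, ho, hq⟩ := AlongLogic.exists_lgo hG hφ hp
  obtain ⟨o', ho', k⟩ := h o ho
  exact hq q o' k ho'

/-- The forcing observation follows the prefixes of the formula and stops where the local formula is
reached. -/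
theorem AtEndLogic.exists_lgo
    (hG : ∀ {p q σ}, r (obs p) (obs q) → G σ → HML.Sat tr σ p → HML.Sat tr σ q)
    {φ : HML Act} (hφ : AtEndLogic G φ) {p : P} (hp : HML.Sat tr φ p) :
    ∃ o, IsLGO tr obs p o ∧
      ∀ q o', LGO.AtEnd r o o' → IsLGO tr obs q o' → HML.Sat tr φ q := by
  induction hφ generalizing p with
  | top => exact ⟨_, .final p, fun q _ _ _ => HML.sat_top q⟩
  | loc σ hσ =>
    refine ⟨_, .final p, ?_⟩
    rintro q _ ⟨k⟩ ⟨⟩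
    exact hG k hσ hp
  | dia a φ _ ih =>
    obtain ⟨p', h, hs⟩ := hp
    obtain ⟨o, ho, hq⟩ := ih hs
    refine ⟨_, .step h ho, ?_⟩
    rintro q _ (_ | ⟨_, _, _, k⟩) (_ | ⟨hq', ho'⟩)
    exact ⟨_, hq', hq _ _ k ho'⟩

theorem logicLE_of_dominated_atEnd
    (hG : ∀ {p q σ}, r (obs p) (obs q) → G σ → HML.Sat tr σ p → HML.Sat tr σ q) {p q : P}
    (h : Dominated (LGO.AtEnd r) (lgoSet tr obs p) (lgoSet tr obs q)) :
    LogicLE tr {φ | AtEndLogic G φ} p q := by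
  intro φ hφ hp
  obtain ⟨o, ho, hq⟩ := AtEndLogic.exists_lgo hG hφ hp
  obtain ⟨o', ho', k⟩ := h o ho
  exact hq q o' k ho'

/-- As `Characterises`, but only for states that share a possible action. -/
def CharacterisesActive (tr : P → Act → P → Prop) (obs : P → L) (r : L → L → Prop)
    (G : HML Act → Prop) : Prop :=
  ∀ (p : P) (Q : Set P) (a : Act), ImageFinite tr p → Q.Finite → (∀ q ∈ Q, ImageFinite tr q) →
    a ∈ initials tr p →
    ∃ σ, G σ ∧ HML.Sat tr σ p ∧ ∀ q ∈ Q, HML.Sat tr σ q → a ∈ initials tr q → r (obs p) (obs q)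

theorem Characterises.active (h : Characterises tr obs r G) :
    CharacterisesActive tr obs r G := by
  intro p Q a hp hQ hI _
  obtain ⟨σ, h₁, h₂, h₃⟩ := h p Q hp hQ hI
  exact ⟨σ, h₁, h₂, fun q hq hs _ => h₃ q hq hs⟩

/-- The last local observation and the earlier ones have separate hypotheses. At the end a whole
linear formula may be used, possibly with further prefixes; earlier, the action that follows is
already known to be possible. Both freedoms are needed for failure traces over `C`. -/
theorem IsLGO.exists_alongLogic (hF : FinitelyClosed F)
    (hfinal : Characterises tr obs r fun φ => AlongLogic G φ ∧ F φ)
    (hstep : CharacterisesActive tr obs r fun σ => G σ ∧ F σ)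
    {p : P} {o : LGO Act L} (ho : IsLGO tr obs p o) (hp : ImageFinite tr p) {Q : Set P}
    (hQ : Q.Finite) (hI : ∀ q ∈ Q, ImageFinite tr q) :
    ∃ φ, (AlongLogic G φ ∧ F φ) ∧ HML.Sat tr φ p ∧
      ∀ q ∈ Q, HML.Sat tr φ q → ∃ o', IsLGO tr obs q o' ∧ LGO.Along r o o' := by
  induction ho generalizing Q with
  | final p =>
    obtain ⟨φ, h₁, h₂, h₃⟩ := hfinal p Q hp hQ hI
    exact ⟨φ, h₁, h₂, fun q hq hs => ⟨_, .final q, .final (h₃ q hq hs)⟩⟩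
  | @step p p' a o h _ ih =>
    obtain ⟨σ, ⟨h₁, h₂⟩, h₃, h₄⟩ := hstep p Q a hp hQ hI ⟨p', h⟩
    obtain ⟨φ, ⟨k₁, k₂⟩, k₃, k₄⟩ :=
      ih (hp.step h) (finite_successors hQ hI a) (imageFinite_of_mem_successors hI a)
    refine ⟨σ.and (.dia a φ), ⟨.and _ _ h₁ (.dia a φ k₁), hF.conj.and h₂ (hF.dia a k₂)⟩,
      HML.sat_and.2 ⟨h₃, p', h, k₃⟩, fun q hq hs => ?_⟩
    obtain ⟨hs₁, q', hq', hs₂⟩ := HML.sat_and.1 hs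
    obtain ⟨o', ho', hoo'⟩ := k₄ q' ⟨q, hq, hq'⟩ hs₂
    exact ⟨_, .step hq' ho', .step a (h₄ q hq hs₁ ⟨q', hq'⟩) hoo'⟩

theorem dominated_along_of_logicLE (hF : FinitelyClosed F)
    (hfinal : Characterises tr obs r fun φ => AlongLogic G φ ∧ F φ)
    (hstep : CharacterisesActive tr obs r fun σ => G σ ∧ F σ)
    {p q : P} (hp : ImageFinite tr p) (hq : ImageFinite tr q)
    (h : LogicLE tr ({φ | AlongLogic G φ} ∩ {φ | F φ}) p q) :
    Dominated (LGO.Along r) (lgoSet tr obs p) (lgoSet tr obs q) := by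
  intro o ho
  obtain ⟨φ, h₁, h₂, h₃⟩ := IsLGO.exists_alongLogic hF hfinal hstep ho hp
    (Set.finite_singleton q) (by rintro _ rfl; exact hq)
  exact h₃ q rfl (h φ h₁ h₂)

theorem Characterises.along (hF : FinitelyClosed F)
    (h : Characterises tr obs r fun σ => G σ ∧ F σ) :
    Characterises tr obs r fun φ => AlongLogic G φ ∧ F φ := by
  intro p Q hp hQ hI
  obtain ⟨σ, ⟨h₁, h₂⟩, h₃, h₄⟩ := h p Q hp hQ hI
  exact ⟨σ.and .top, ⟨.and _ _ h₁ .top, hF.conj.and h₂ hF.conj.top⟩,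
    HML.sat_and.2 ⟨h₃, HML.sat_top p⟩, fun q hq hs => h₄ q hq (HML.sat_and.1 hs).1⟩

theorem Characterises.atEnd (h : Characterises tr obs r fun σ => G σ ∧ F σ) :
    Characterises tr obs r fun φ => AtEndLogic G φ ∧ F φ :=
  h.mono fun σ hσ => ⟨.loc σ hσ.1, hσ.2⟩

theorem IsLGO.exists_atEndLogic (hF : FinitelyClosed F)
    (hfinal : Characterises tr obs r fun φ => AtEndLogic G φ ∧ F φ)
    {p : P} {o : LGO Act L} (ho : IsLGO tr obs p o) (hp : ImageFinite tr p) {Q : Set P}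
    (hQ : Q.Finite) (hI : ∀ q ∈ Q, ImageFinite tr q) :
    ∃ φ, (AtEndLogic G φ ∧ F φ) ∧ HML.Sat tr φ p ∧
      ∀ q ∈ Q, HML.Sat tr φ q → ∃ o', IsLGO tr obs q o' ∧ LGO.AtEnd r o o' := by
  induction ho generalizing Q with
  | final p =>
    obtain ⟨φ, h₁, h₂, h₃⟩ := hfinal p Q hp hQ hI
    exact ⟨φ, h₁, h₂, fun q hq hs => ⟨_, .final q, .final (h₃ q hq hs)⟩⟩
  | @step p p' a o h _ ih =>
    obtain ⟨φ, ⟨k₁, k₂⟩, k₃, k₄⟩ :=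
      ih (hp.step h) (finite_successors hQ hI a) (imageFinite_of_mem_successors hI a)
    refine ⟨.dia a φ, ⟨.dia a φ k₁, hF.dia a k₂⟩, ⟨p', h, k₃⟩, ?_⟩
    rintro q hq ⟨q', hq', hs⟩
    obtain ⟨o', ho', hoo'⟩ := k₄ q' ⟨q, hq, hq'⟩ hs
    exact ⟨_, .step hq' ho', .step _ _ a hoo'⟩

theorem dominated_atEnd_of_logicLE (hF : FinitelyClosed F)
    (hfinal : Characterises tr obs r fun φ => AtEndLogic G φ ∧ F φ)
    {p q : P} (hp : ImageFinite tr p) (hq : ImageFinite tr q)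
    (h : LogicLE tr ({φ | AtEndLogic G φ} ∩ {φ | F φ}) p q) :
    Dominated (LGO.AtEnd r) (lgoSet tr obs p) (lgoSet tr obs q) := by
  intro o ho
  obtain ⟨φ, h₁, h₂, h₃⟩ := IsLGO.exists_atEndLogic hF hfinal ho hp
    (Set.finite_singleton q) (by rintro _ rfl; exact hq)
  exact h₃ q rfl (h φ h₁ h₂)

theorem dominated_along_eq_iff {A B : Set (LGO Act L)} :
    Dominated (LGO.Along Eq) A B ↔ A ⊆ B := by
  constructor
  · intro h o ho
    obtain ⟨o', ho', k⟩ := h o ho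
    rwa [LGO.along_eq_iff.1 k]
  · exact fun h o ho => ⟨o, h ho, LGO.along_eq_iff.2 rfl⟩

end Linear

/-! ### Branching observations -/

section Branching

variable {Act : Type u} {P : Type v} {L : Type w} {tr : P → Act → P → Prop} {obs : P → L}
  {K : Set (HML Act)} {G F : HML Act → Prop}

theorem BGO.exists_eq_node (o : BGO Act L) : ∃ l S, o = BGO.node l S := by
  induction o using BGO.induction with
  | h l S _ => exact ⟨l, S, rfl⟩

theorem node_mem_bgoSet {p : P} {l : L} {S : Finset (Act × BGO Act L)} :
    BGO.node l S ∈ bgoSet tr obs p ↔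
      l = obs p ∧ ∀ c ∈ S, ∃ p', tr p c.1 p' ∧ c.2 ∈ bgoSet tr obs p' := by
  constructor
  · intro h
    generalize hx : BGO.node l S = x at h
    obtain ⟨_, S', p', h₁, h₂⟩ := h
    obtain ⟨rfl, rfl⟩ := BGO.node_inj.1 hx
    exact ⟨rfl, fun c hc => ⟨p' c, h₁ c hc, h₂ c hc⟩⟩
  · rintro ⟨rfl, h⟩
    have : Nonempty P := ⟨p⟩
    choose! p' h₁ h₂ using h
    exact IsBGO.node p S p' h₁ h₂

theorem BGO.deterministic_node {l : L} {S : Finset (Act × BGO Act L)} :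
    (BGO.node l S).Deterministic ↔
      (∀ c ∈ S, ∀ d ∈ S, c.1 = d.1 → c = d) ∧ ∀ c ∈ S, c.2.Deterministic := by
  constructor
  · intro h
    generalize hx : BGO.node l S = x at h
    obtain ⟨_, S', h₁, h₂⟩ := h
    obtain ⟨rfl, rfl⟩ := BGO.node_inj.1 hx
    exact ⟨h₁, h₂⟩
  · exact fun h => .node l S h.1 h.2

theorem node_mem_dbgoSet {p : P} {l : L} {S : Finset (Act × BGO Act L)} :
    BGO.node l S ∈ dbgoSet tr obs p ↔
      l = obs p ∧ (∀ c ∈ S, ∀ d ∈ S, c.1 = d.1 → c = d) ∧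
        ∀ c ∈ S, ∃ p', tr p c.1 p' ∧ c.2 ∈ dbgoSet tr obs p' := by
  simp only [dbgoSet, Set.mem_inter_iff, node_mem_bgoSet, Set.mem_ofPred_eq,
    BGO.deterministic_node]
  constructor
  · rintro ⟨⟨h₀, h₁⟩, h₂, h₃⟩
    refine ⟨h₀, h₂, fun c hc => ?_⟩
    obtain ⟨p', h, k⟩ := h₁ c hc
    exact ⟨p', h, k, h₃ c hc⟩
  · rintro ⟨h₀, h₁, h₂⟩
    refine ⟨⟨h₀, fun c hc => ?_⟩, h₁, fun c hc => ?_⟩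
    · obtain ⟨p', h, k⟩ := h₂ c hc
      exact ⟨p', h, k.1⟩
    · obtain ⟨p', h, k⟩ := h₂ c hc
      exact k.2

theorem leaf_mem_dbgoSet (p : P) : BGO.node (obs p) ∅ ∈ dbgoSet tr obs p :=
  node_mem_dbgoSet.2 ⟨rfl, by simp, by simp⟩

/-- Finitely many observations of a state can be merged into one. -/
theorem exists_bgo_above {X : Type*} {s : Set X} (hs : s.Finite) (p : P) (o : X → BGO Act L)
    (ho : ∀ x ∈ s, o x ∈ bgoSet tr obs p) :
    ∃ o' ∈ bgoSet tr obs p, ∀ x ∈ s, ∀ q, o' ∈ bgoSet tr obs q → o x ∈ bgoSet tr obs q := by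
  classical
  induction s, hs using Set.Finite.induction_on with
  | empty => exact ⟨_, (leaf_mem_dbgoSet p).1, by simp⟩
  | @insert x s _ _ ih =>
    obtain ⟨o₁, h₁, h₂⟩ := ih fun y hy => ho y (Set.mem_insert_of_mem _ hy)
    have hx := ho x (Set.mem_insert _ _)
    obtain ⟨l, S, rfl⟩ := o₁.exists_eq_node
    obtain ⟨l', S', hx'⟩ := (o x).exists_eq_node
    rw [hx', node_mem_bgoSet] at hx
    rw [node_mem_bgoSet] at h₁
    -- Both trees have root label `obs p`, so it suffices to unite their sets of children; a state
    -- with the union has each part.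
    refine ⟨BGO.node (obs p) (S ∪ S'), node_mem_bgoSet.2 ⟨rfl, fun c hc => ?_⟩,
      fun y hy q hq => ?_⟩
    · rcases Finset.mem_union.1 hc with hc | hc
      · exact h₁.2 c hc
      · exact hx.2 c hc
    · rw [node_mem_bgoSet] at hq
      rcases hy with rfl | hy
      · rw [hx', node_mem_bgoSet, hx.1]
        exact ⟨hq.1, fun c hc => hq.2 c (Finset.mem_union_right _ hc)⟩
      · refine h₂ y hy q (node_mem_bgoSet.2 ⟨h₁.1.trans hq.1, fun c hc => ?_⟩)
        exact hq.2 c (Finset.mem_union_left _ hc)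

/-- Otherwise each of the finitely many `a`-successors of `q` misses some observation of `p'`.
Merging these gives one observation of `p'` missed by all of them, and placing it under an `a`-arc
contradicts the inclusion for `p` and `q`. -/
theorem exists_succ_bgoSet_subset {p q p' : P} {a : Act} (hq : ImageFinite tr q)
    (h : bgoSet tr obs p ⊆ bgoSet tr obs q) (hp' : tr p a p') :
    ∃ q', tr q a q' ∧ bgoSet tr obs p' ⊆ bgoSet tr obs q' := by
  by_contra! hcon
  have hcon' : ∀ q', tr q a q' → ∃ o, o ∈ bgoSet tr obs p' ∧ o ∉ bgoSet tr obs q' :=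
    fun q' hq' => Set.not_subset.1 (hcon q' hq')
  have : Nonempty (BGO Act L) := ⟨BGO.node (obs p) ∅⟩
  choose! o h₁ h₂ using hcon'
  obtain ⟨o', ho', habove⟩ := exists_bgo_above (hq.finite_succ a) p' o h₁
  have hmem : BGO.node (obs p) {(a, o')} ∈ bgoSet tr obs p :=
    node_mem_bgoSet.2 ⟨rfl, fun c hc => by
      rw [Finset.mem_singleton] at hc
      subst hc
      exact ⟨p', hp', ho'⟩⟩
  obtain ⟨q', hq', hs⟩ := (node_mem_bgoSet.1 (h hmem)).2 _ (Finset.mem_singleton_self _)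
  exact h₂ q' hq' (habove q' hq' q' hs)

theorem obs_eq_of_bgoSet_subset {p q : P} (h : bgoSet tr obs p ⊆ bgoSet tr obs q) :
    obs p = obs q :=
  (node_mem_bgoSet.1 (h (leaf_mem_dbgoSet p).1)).1

theorem logicLE_of_bgoSet_subset
    (hK : ∀ {p q σ}, obs p = obs q → σ ∈ K → (HML.Sat tr σ p ↔ HML.Sat tr σ q)) {p q : P}
    (hq : ImageFinite tr q) (h : bgoSet tr obs p ⊆ bgoSet tr obs q) :
    LogicLE tr {φ | SimLogic K φ} p q := by
  intro φ hφ hp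
  induction hφ generalizing p q with
  | pos σ hσ => exact (hK (obs_eq_of_bgoSet_subset h) hσ).1 hp
  | neg σ hσ => exact fun hs => hp ((hK (obs_eq_of_bgoSet_subset h) hσ).2 hs)
  | conj φ _ ih => exact fun i => ih i hq h (hp i)
  | dia a φ _ ih =>
    obtain ⟨p', hp', hs⟩ := hp
    obtain ⟨q', hq', k⟩ := exists_succ_bgoSet_subset hq h hp'
    exact ⟨q', hq', ih (hq.step hq') k hs⟩

theorem SymClosure.simLogic {σ : HML Act} (h : SymClosure K σ) : SimLogic K σ := by
  induction h with
  | pos σ h => exact .pos σ h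
  | neg σ h => exact .neg σ h
  | conj σ _ ih => exact .conj σ ih

/-- The describing formula follows the tree: a local formula for the root, conjoined with one
prefixed formula per child. -/
theorem IsBGO.exists_simLogic (hF : FinitelyClosed F)
    (hloc : Characterises tr obs Eq fun σ => SymClosure K σ ∧ F σ)
    {p : P} {o : BGO Act L} (ho : IsBGO tr obs p o) (hp : ImageFinite tr p) {Q : Set P}
    (hQ : Q.Finite) (hI : ∀ q ∈ Q, ImageFinite tr q) :
    ∃ φ, (SimLogic K φ ∧ F φ) ∧ HML.Sat tr φ p ∧
      ∀ q ∈ Q, HML.Sat tr φ q → o ∈ bgoSet tr obs q := by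
  induction ho generalizing Q with
  | node p S p' h₁ _ ih =>
    have hG := (simLogic_conjClosed K).inf hF.conj
    obtain ⟨σ, ⟨k₁, k₂⟩, k₃, k₄⟩ := hloc p Q hp hQ hI
    obtain ⟨φ, m₁, m₂, m₃⟩ := hG.exists_forall (tr := tr) S.finite_toSet p
      -- The guard `q ∈ Q` is needed because the induction hypothesis controls only successors of
      -- states in `Q`.
      (C := fun c q => q ∈ Q → ∃ q', tr q c.1 q' ∧ c.2 ∈ bgoSet tr obs q') (by
        intro c hc
        obtain ⟨φ, n₁, n₂, n₃⟩ := ih c hc (hp.step (h₁ c hc)) (finite_successors hQ hI c.1)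
          (imageFinite_of_mem_successors hI c.1)
        refine ⟨.dia c.1 φ, ⟨.dia _ _ n₁.1, hF.dia _ n₁.2⟩, ⟨p' c, h₁ c hc, n₂⟩, ?_⟩
        rintro q ⟨q', hq', hs⟩ hq
        exact ⟨q', hq', n₃ q' ⟨q, hq, hq'⟩ hs⟩)
    refine ⟨σ.and φ, hG.and ⟨k₁.simLogic, k₂⟩ m₁, HML.sat_and.2 ⟨k₃, m₂⟩, fun q hq hs => ?_⟩
    obtain ⟨hs₁, hs₂⟩ := HML.sat_and.1 hs
    exact node_mem_bgoSet.2 ⟨k₄ q hq hs₁, fun c hc => m₃ q hs₂ c hc hq⟩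

theorem bgoSet_subset_of_logicLE (hF : FinitelyClosed F)
    (hloc : Characterises tr obs Eq fun σ => SymClosure K σ ∧ F σ)
    {p q : P} (hp : ImageFinite tr p) (hq : ImageFinite tr q)
    (h : LogicLE tr ({φ | SimLogic K φ} ∩ {φ | F φ}) p q) :
    bgoSet tr obs p ⊆ bgoSet tr obs q := by
  intro o ho
  obtain ⟨φ, h₁, h₂, h₃⟩ := IsBGO.exists_simLogic hF hloc ho hp
    (Set.finite_singleton q) (by rintro _ rfl; exact hq)
  exact h₃ q rfl (h φ h₁ h₂)

/-! ### Deterministic branching observations -/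

/-- `o ≤ o'` when every state with the deterministic observation `o'` has `o` as well. -/
def DetBelow (tr : P → Act → P → Prop) (obs : P → L) (o o' : BGO Act L) : Prop :=
  ∀ q, o' ∈ dbgoSet tr obs q → o ∈ dbgoSet tr obs q

/-- Directedness plays the role that merging plays in `exists_bgo_above`. -/
theorem exists_detBelow_of_finite {O : Set (BGO Act L)} (hne : O.Nonempty)
    (hdir : DirectedOn (DetBelow tr obs) O) {X : Type*} {s : Set X} (hs : s.Finite)
    (o : X → BGO Act L) (ho : ∀ x ∈ s, o x ∈ O) :
    ∃ o' ∈ O, ∀ x ∈ s, DetBelow tr obs (o x) o' := by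
  induction s, hs using Set.Finite.induction_on with
  | empty =>
    obtain ⟨o', ho'⟩ := hne
    exact ⟨o', ho', by simp⟩
  | @insert x s _ _ ih =>
    obtain ⟨o₁, h₁, h₂⟩ := ih fun y hy => ho y (Set.mem_insert_of_mem _ hy)
    obtain ⟨o₂, h₃, h₄, h₅⟩ := hdir o₁ h₁ (o x) (ho x (Set.mem_insert _ _))
    refine ⟨o₂, h₃, fun y hy => ?_⟩
    rcases hy with rfl | hy
    · exact h₅
    · exact fun q hq => h₂ y hy q (h₄ q hq)

open Classical in
/-- The deterministic observation with root `l`, arcs `A` and subtrees given by `o`. -/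
noncomputable def detNode (l : L) (A : Finset Act) (o : Act → BGO Act L) : BGO Act L :=
  BGO.node l (A.image fun a => (a, o a))

theorem detNode_mem_dbgoSet {p : P} {l : L} {A : Finset Act} {o : Act → BGO Act L} :
    detNode l A o ∈ dbgoSet tr obs p ↔
      l = obs p ∧ ∀ a ∈ A, ∃ p', tr p a p' ∧ o a ∈ dbgoSet tr obs p' := by
  classical
  rw [detNode, node_mem_dbgoSet]
  constructor
  · rintro ⟨h₁, -, h₂⟩
    exact ⟨h₁, fun a ha => h₂ (a, o a) (Finset.mem_image_of_mem _ ha)⟩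
  · rintro ⟨h₁, h₂⟩
    refine ⟨h₁, ?_, ?_⟩
    · intro c hc d hd hcd
      obtain ⟨a, -, rfl⟩ := Finset.mem_image.1 hc
      obtain ⟨b, -, rfl⟩ := Finset.mem_image.1 hd
      obtain rfl : a = b := hcd
      rfl
    · intro c hc
      obtain ⟨a, ha, rfl⟩ := Finset.mem_image.1 hc
      exact h₂ a ha

/-- A deterministic branching formula true at `p` is forced, on image-finite states, by a
directed set of deterministic observations of `p`. -/
theorem DetLogic.exists_directed
    (hG : ∀ {p q σ}, obs p = obs q → G σ → HML.Sat tr σ p → HML.Sat tr σ q)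
    {φ : HML Act} (hφ : DetLogic G φ) {p : P} (hp : HML.Sat tr φ p) :
    ∃ O : Set (BGO Act L), O.Nonempty ∧ O ⊆ dbgoSet tr obs p ∧
      DirectedOn (DetBelow tr obs) O ∧
      ∀ q, ImageFinite tr q → O ⊆ dbgoSet tr obs q → HML.Sat tr φ q := by
  classical
  induction hφ generalizing p with
  | top =>
    refine ⟨{BGO.node (obs p) ∅}, Set.singleton_nonempty _,
      Set.singleton_subset_iff.2 (leaf_mem_dbgoSet p), ?_, fun q _ _ => HML.sat_top q⟩
    rintro _ rfl _ rfl
    exact ⟨_, rfl, fun _ => id, fun _ => id⟩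
  | and σ φ hσ _ ih =>
    obtain ⟨h₁, h₂⟩ := HML.sat_and.1 hp
    obtain ⟨O, hne, hOp, hdir, hO⟩ := ih h₂
    refine ⟨O, hne, hOp, hdir, fun q hq hOq => HML.sat_and.2 ⟨hG ?_ hσ h₁, hO q hq hOq⟩⟩
    -- Any member of `O` is an observation of both states, and its root label makes their local
    -- observations equal; this is why `O` must be nonempty.
    obtain ⟨o, ho⟩ := hne
    have hop := hOp ho
    have hoq := hOq ho
    obtain ⟨l, S, rfl⟩ := o.exists_eq_node
    exact (node_mem_dbgoSet.1 hop).1.symm.trans (node_mem_dbgoSet.1 hoq).1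
  | branch X φ _ ih =>
    choose p' hp' hs using hp
    choose O hne hOp hdir hO using fun a => ih a (hs a)
    choose o₀ ho₀ using hne
    -- The leaf is a default value outside `X`; `N` only uses arcs from `X`.
    let ext (o : X → BGO Act L) (a : Act) : BGO Act L :=
      if h : a ∈ X then o ⟨a, h⟩ else BGO.node (obs p) ∅
    have hext (o : X → BGO Act L) (a : X) : ext o a = o a := by simp [ext]
    let N (A : Finset X) (o : X → BGO Act L) : BGO Act L :=
      detNode (obs p) (A.map (Function.Embedding.subtype _)) (ext o)
    have hN (q : P) (A : Finset X) (o : X → BGO Act L) : N A o ∈ dbgoSet tr obs q ↔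
        obs p = obs q ∧ ∀ a ∈ A, ∃ q', tr q a.1 q' ∧ o a ∈ dbgoSet tr obs q' := by
      rw [detNode_mem_dbgoSet]
      refine and_congr_right fun _ => ⟨fun h a ha => ?_, fun h b hb => ?_⟩
      · rw [← hext o a]
        exact h a (Finset.mem_map_of_mem _ ha)
      · obtain ⟨a, ha, rfl⟩ := Finset.mem_map.1 hb
        have := h a ha
        rwa [← hext o a] at this
    -- `X` may be infinite while observations are finite, so all finite sets `A` of arcs are
    -- admitted, with subtrees drawn from the directed sets of the fixed witnesses `p' a`. Upper
    -- bounds unite the arcs and take bounds arcwise.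
    refine ⟨{x | ∃ A o, (∀ a, o a ∈ O a) ∧ x = N A o}, ⟨_, ∅, o₀, ho₀, rfl⟩, ?_, ?_, ?_⟩
    · rintro _ ⟨A, o, ho, rfl⟩
      exact (hN p A o).2 ⟨rfl, fun a _ => ⟨p' a, hp' a, hOp a (ho a)⟩⟩
    · rintro _ ⟨A, o, ho, rfl⟩ _ ⟨A', o', ho', rfl⟩
      choose m hm h₁ h₂ using fun a => hdir a (o a) (ho a) (o' a) (ho' a)
      refine ⟨_, ⟨A ∪ A', m, hm, rfl⟩, fun q hq => ?_, fun q hq => ?_⟩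
      · rw [hN] at hq ⊢
        refine ⟨hq.1, fun a ha => ?_⟩
        obtain ⟨q', k₁, k₂⟩ := hq.2 a (Finset.mem_union_left _ ha)
        exact ⟨q', k₁, h₁ a q' k₂⟩
      · rw [hN] at hq ⊢
        refine ⟨hq.1, fun a ha => ?_⟩
        obtain ⟨q', k₁, k₂⟩ := hq.2 a (Finset.mem_union_right _ ha)
        exact ⟨q', k₁, h₂ a q' k₂⟩
    · intro q hq hOq a
      by_contra hcon
      have hcon' : ∀ q', tr q a.1 q' → ∃ o, o ∈ O a ∧ o ∉ dbgoSet tr obs q' := fun q' hq' =>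
        Set.not_subset.1 fun hsub => hcon ⟨q', hq', hO a q' (hq.step hq') hsub⟩
      have : Nonempty (BGO Act L) := ⟨o₀ a⟩
      choose! o h₁ h₂ using hcon'
      obtain ⟨m, hm, habove⟩ :=
        exists_detBelow_of_finite ⟨_, ho₀ a⟩ (hdir a) (hq.finite_succ a.1) o h₁
      -- Only the arc `a` is displayed, but membership asks for a choice at every arc of `X`; `o₀`
      -- supplies the others.
      have hmem := hOq ⟨{a}, Function.update o₀ a m, fun b => ?_, rfl⟩
      · obtain ⟨q', hq', hmq⟩ := ((hN q _ _).1 hmem).2 a (Finset.mem_singleton_self _)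
        rw [Function.update_self] at hmq
        exact h₂ q' hq' (habove q' hq' q' hmq)
      · by_cases hb : b = a
        · subst hb
          rwa [Function.update_self]
        · rw [Function.update_of_ne hb]
          exact ho₀ b

theorem logicLE_of_dbgoSet_subset
    (hG : ∀ {p q σ}, obs p = obs q → G σ → HML.Sat tr σ p → HML.Sat tr σ q) {p q : P}
    (hq : ImageFinite tr q) (h : dbgoSet tr obs p ⊆ dbgoSet tr obs q) :
    LogicLE tr {φ | DetLogic G φ} p q := by
  intro φ hφ hp
  obtain ⟨O, -, hOp, -, hO⟩ := DetLogic.exists_directed hG hφ hp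
  exact hO q hq (hOp.trans h)

/-- Determinism leaves one child per arc label, so the children are described by a single branching
conjunction indexed by the finite set of labels. -/
theorem IsBGO.exists_detLogic (hF : FinitelyClosed F)
    (hloc : Characterises tr obs Eq fun σ => G σ ∧ F σ)
    {p : P} {o : BGO Act L} (ho : IsBGO tr obs p o) (hdet : o.Deterministic)
    (hp : ImageFinite tr p) {Q : Set P}
    (hQ : Q.Finite) (hI : ∀ q ∈ Q, ImageFinite tr q) :
    ∃ φ, (DetLogic G φ ∧ F φ) ∧ HML.Sat tr φ p ∧
      ∀ q ∈ Q, HML.Sat tr φ q → o ∈ dbgoSet tr obs q := by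
  induction ho generalizing Q with
  | node p S p' h₁ _ ih =>
    obtain ⟨d₁, d₂⟩ := BGO.deterministic_node.1 hdet
    obtain ⟨σ, ⟨k₁, k₂⟩, k₃, k₄⟩ := hloc p Q hp hQ hI
    let X : Set Act := Prod.fst '' (S : Set (Act × BGO Act L))
    have hX : X.Finite := S.finite_toSet.image _
    have key (a : X) : ∃ c ∈ S, c.1 = a.1 := a.2
    choose c hc hca using key
    choose φ n₁ n₂ n₃ using fun a : X => ih (c a) (hc a) (d₂ _ (hc a))
      (hp.step (h₁ _ (hc a))) (finite_successors hQ hI (c a).1)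
      (imageFinite_of_mem_successors hI (c a).1)
    have : Finite X := hX
    refine ⟨σ.and (.conj fun a : X => .dia a.1 (φ a)),
      ⟨.and _ _ k₁ (.branch X φ fun a => (n₁ a).1),
        hF.conj.and k₂ (hF.conj _ _ this fun a => hF.dia _ (n₁ a).2)⟩,
      HML.sat_and.2 ⟨k₃, fun a => ⟨p' (c a), hca a ▸ h₁ _ (hc a), n₂ a⟩⟩, fun q hq hs => ?_⟩
    obtain ⟨hs₁, hs₂⟩ := HML.sat_and.1 hs
    refine node_mem_dbgoSet.2 ⟨k₄ q hq hs₁, d₁, fun d hd => ?_⟩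
    obtain ⟨q', hq', hs'⟩ := hs₂ ⟨d.1, d, hd, rfl⟩
    -- The child chosen for the label of `d` is `d` itself, by determinism.
    obtain hcd := d₁ _ (hc ⟨d.1, d, hd, rfl⟩) d hd (hca _)
    have := n₃ _ q' ⟨q, hq, by rw [hca]; exact hq'⟩ hs'
    rw [hcd] at this
    exact ⟨q', hq', this⟩

theorem dbgoSet_subset_of_logicLE (hF : FinitelyClosed F)
    (hloc : Characterises tr obs Eq fun σ => G σ ∧ F σ)
    {p q : P} (hp : ImageFinite tr p) (hq : ImageFinite tr q)
    (h : LogicLE tr ({φ | DetLogic G φ} ∩ {φ | F φ}) p q) :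
    dbgoSet tr obs p ⊆ dbgoSet tr obs q := by
  intro o ho
  obtain ⟨φ, h₁, h₂, h₃⟩ := IsBGO.exists_detLogic hF hloc ho.1 ho.2 hp
    (Set.finite_singleton q) (by rintro _ rfl; exact hq)
  exact h₃ q rfl (h φ h₁ h₂)

end Branching

/-! ### The unified logical characterisation -/

section Unified

variable {Act : Type u} {P : Type v} {L : Type w} {tr : P → Act → P → Prop} {obs : P → L}
  {sup sub : L → L → Prop} {K : Set (HML Act)} {F : HML Act → Prop}

/-- The negative formulas over `K` express the preorder `sup` on local observations, possibly
with the help of the actions that follow. -/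
structure ExpressesSup (tr : P → Act → P → Prop) (obs : P → L) (sup sub : L → L → Prop)
    (K : Set (HML Act)) (F : HML Act → Prop) : Prop where
  refl : ∀ x, sup x x
  trans : ∀ x y z, sup x y → sup y z → sup x z
  sub_of_sup : ∀ x y, sup x y → sub y x
  along : Characterises tr obs sup fun φ => AlongLogic (NegClosure K) φ ∧ F φ
  active : CharacterisesActive tr obs sup fun σ => NegClosure K σ ∧ F σ
  atEnd : Characterises tr obs sup fun φ => AtEndLogic (NegClosure K) φ ∧ F φ

theorem Expresses.expressesSup (E : Expresses tr obs sub K F) (hF : FinitelyClosed F)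
    (h : ∀ x y, sup x y ↔ sub y x) : ExpressesSup tr obs sup sub K F := by
  obtain rfl : sup = fun x y => sub y x := by
    funext x y
    exact propext (h x y)
  have hneg := E.characterises_neg hF
  exact ⟨E.refl, fun x y z hxy hyz => E.trans z y x hyz hxy, fun _ _ => id, hneg.along hF,
    hneg.active, hneg.atEnd⟩

/-- Negative formulas can say that a state is terminated but not that it can act. The latter is
supplied by prefixes: inside a run by the next action, and at its end by a formula `a⊤`, which both
linear logics contain. -/
theorem expressesSup_complete (hF : FinitelyClosed F) (hnz : F HML.nonzero) :
    ExpressesSup tr (terminated tr) Eq boolSub (constraintLogic .C) F := by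
  have hactive {p : P} {a : Act} (h : a ∈ initials tr p) : terminated tr p = false := by
    rw [← Bool.not_eq_true, terminated_eq_true, not_not]
    exact ⟨a, h⟩
  have hneg := (expresses_complete (tr := tr) hnz).characterises_neg hF
  -- Stated for an abstract class `H` containing every `a⊤`, so that it serves both failure traces
  -- and failures.
  have final {H : HML Act → Prop} (hH : ∀ a : Act, H (.dia a .top))
      (hc : Characterises tr (terminated tr) (fun x y => boolSub y x) fun φ => H φ ∧ F φ) :
      Characterises tr (terminated tr) Eq fun φ => H φ ∧ F φ := by
    intro p Q hp hQ hI
    by_cases hterm : terminated tr p = true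
    · obtain ⟨σ, h₁, h₂, h₃⟩ := hc p Q hp hQ hI
      exact ⟨σ, h₁, h₂, fun q hq hs => hterm.trans (h₃ q hq hs hterm).symm⟩
    · rw [terminated_eq_true, not_not] at hterm
      obtain ⟨a, p', h⟩ := hterm
      refine ⟨.dia a .top, ⟨hH a, hF.dia a hF.conj.top⟩, ⟨p', h, HML.sat_top p'⟩, ?_⟩
      rintro q hq ⟨q', hq', -⟩
      rw [hactive ⟨p', h⟩, hactive ⟨q', hq'⟩]
  refine ⟨fun _ => rfl, fun _ _ _ => Eq.trans, ?_, final (fun a => .dia a _ .top) (hneg.along hF),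
    ?_, final (fun a => .dia a _ .top) hneg.atEnd⟩
  · rintro x _ rfl
    exact id
  · intro p Q a _ _ _ h
    -- With a common possible action neither state is terminated, so `⊤` suffices.
    exact ⟨.top, ⟨(negClosure_conjClosed _).top, hF.conj.top⟩, HML.sat_top p, fun q _ _ hq => by
      rw [hactive h, hactive hq]⟩

variable {N : Constraint}

theorem logicLE_of_obsLEWith (E : Expresses tr obs sub (constraintLogic N) F)
    (hsup : ∀ x y, sup x y → sub y x) (Y : SemKind) {p q : P} (hq : ImageFinite tr q)
    (h : obsLEWith tr obs sup sub Y p q) : LogicLE tr (unifiedLogic N Y) p q := by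
  cases Y with
  | simulation =>
    exact logicLE_of_bgoSet_subset (fun h hσ => ⟨E.sound _ _ (h ▸ E.refl _) _ hσ,
      E.sound _ _ (h ▸ E.refl _) _ hσ⟩) hq h
  | readyTrace =>
    exact logicLE_of_dominated_along E.sound_symClosure (dominated_along_eq_iff.2 h)
  | failureTrace =>
    exact logicLE_of_dominated_along (fun h => E.sound_negClosure (hsup _ _ h)) h
  | readiness => exact logicLE_of_dominated_atEnd E.sound_symClosure h
  | failures => exact logicLE_of_dominated_atEnd (fun h => E.sound_negClosure (hsup _ _ h)) h
  | partialOfferTrace => exact logicLE_of_dominated_along E.sound_posClosure h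
  | partialOffer => exact logicLE_of_dominated_atEnd E.sound_posClosure h
  | deterministic => exact logicLE_of_dbgoSet_subset E.sound_symClosure hq h

theorem obsLEWith_of_logicLE (hF : FinitelyClosed F)
    (E : Expresses tr obs sub (constraintLogic N) F)
    (E' : ExpressesSup tr obs sup sub (constraintLogic N) F) (Y : SemKind) {p q : P}
    (hp : ImageFinite tr p) (hq : ImageFinite tr q)
    (h : LogicLE tr (unifiedLogic N Y ∩ {φ | F φ}) p q) : obsLEWith tr obs sup sub Y p q := by
  have hsym := E.characterises_sym hF
  have hpos := E.characterises_pos hF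
  cases Y with
  | simulation => exact bgoSet_subset_of_logicLE hF hsym hp hq h
  | readyTrace =>
    exact dominated_along_eq_iff.1
      (dominated_along_of_logicLE hF (hsym.along hF) hsym.active hp hq h)
  | failureTrace => exact dominated_along_of_logicLE hF E'.along E'.active hp hq h
  | readiness => exact dominated_atEnd_of_logicLE hF hsym.atEnd hp hq h
  | failures => exact dominated_atEnd_of_logicLE hF E'.atEnd hp hq h
  | partialOfferTrace =>
    exact dominated_along_of_logicLE hF (hpos.along hF) hpos.active hp hq h
  | partialOffer => exact dominated_atEnd_of_logicLE hF hpos.atEnd hp hq h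
  | deterministic => exact dbgoSet_subset_of_logicLE hF hsym hp hq h

/-- Soundness holds for the entire logic; `F` matters only for having enough formulas to recover the
observations. -/
theorem logicLE_iff_obsLEWith (hF : FinitelyClosed F)
    (E : Expresses tr obs sub (constraintLogic N) F)
    (E' : ExpressesSup tr obs sup sub (constraintLogic N) F) (Y : SemKind) {p q : P}
    (hp : ImageFinite tr p) (hq : ImageFinite tr q) :
    LogicLE tr (unifiedLogic N Y ∩ {φ | F φ}) p q ↔ obsLEWith tr obs sup sub Y p q :=
  ⟨obsLEWith_of_logicLE hF E E' Y hp hq,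
    fun h φ hφ => logicLE_of_obsLEWith E E'.sub_of_sup Y hq h φ hφ.1⟩

theorem logicLE_iff_obsLE (hF : FinitelyClosed F) (hnz : N = .C → F HML.nonzero) (Y : SemKind)
    {p q : P} (hp : ImageFinite tr p) (hq : ImageFinite tr q) :
    LogicLE tr (unifiedLogic N Y ∩ {φ | F φ}) p q ↔ ObsLE tr N Y p q := by
  cases N with
  | U =>
    exact logicLE_iff_obsLEWith hF expresses_universal
      (expresses_universal.expressesSup hF fun _ _ => eq_comm) Y hp hq
  | C =>
    exact logicLE_iff_obsLEWith hF (expresses_complete (hnz rfl))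
      (expressesSup_complete hF (hnz rfl)) Y hp hq
  | I =>
    exact logicLE_iff_obsLEWith hF (expresses_initials hF)
      ((expresses_initials hF).expressesSup hF fun _ _ => Iff.rfl) Y hp hq
  | T =>
    exact logicLE_iff_obsLEWith hF (expresses_traces hF)
      ((expresses_traces hF).expressesSup hF fun _ _ => Iff.rfl) Y hp hq
  | S =>
    exact logicLE_iff_obsLEWith hF (expresses_simulation hF)
      ((expresses_simulation hF).expressesSup hF fun _ _ => Iff.rfl) Y hp hq

theorem finitary_nonzero [Finite Act] : HML.Finitary (HML.nonzero (Act := Act)) := by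
  have h := finitelyClosed_finitary (Act := Act)
  exact h.neg (h.conj _ _ inferInstance fun a => h.neg (h.dia a h.conj.top))

theorem obsLEWith_iff_obsInclWith (E : Expresses tr obs sub K F)
    (E' : ExpressesSup tr obs sup sub K F) (Y : SemKind) (p q : P) :
    obsLEWith tr obs sup sub Y p q ↔ obsInclWith tr obs sup sub Y p q := by
  have along {r : L → L → Prop} (h : ∀ x, r x x) (h' : ∀ x y z, r x y → r y z → r x z)
      {A B : Set (LGO Act L)} := dominated_iff_closureBy_subset (A := A) (B := B)
    (LGO.Along.refl h) (LGO.Along.trans h')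
  have atEnd {r : L → L → Prop} (h : ∀ x, r x x) (h' : ∀ x y z, r x y → r y z → r x z)
      {A B : Set (LGO Act L)} := dominated_iff_closureBy_subset (A := A) (B := B)
    (LGO.AtEnd.refl h) (LGO.AtEnd.trans h')
  cases Y with
  | simulation => exact Iff.rfl
  | readyTrace => exact Iff.rfl
  | failureTrace => exact along E'.refl E'.trans
  | readiness => exact atEnd (fun _ => rfl) fun _ _ _ => Eq.trans
  | failures => exact atEnd E'.refl E'.trans
  | partialOfferTrace => exact along E.refl E.trans
  | partialOffer => exact atEnd E.refl E.trans
  | deterministic => exact Iff.rfl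

/-- Only reflexivity and transitivity of the relations on local observations enter. The unrestricted
`F` makes these available without conditions on `Act` or on the states. -/
theorem obsLE_iff_obsIncl (N : Constraint) (Y : SemKind) (p q : P) :
    ObsLE tr N Y p q ↔ ObsIncl tr N Y p q := by
  have hF := finitelyClosed_true (Act := Act)
  cases N with
  | U =>
    exact obsLEWith_iff_obsInclWith expresses_universal
      (expresses_universal.expressesSup hF fun _ _ => eq_comm) Y p q
  | C =>
    exact obsLEWith_iff_obsInclWith (expresses_complete trivial)
      (expressesSup_complete hF trivial) Y p q
  | I =>
    exact obsLEWith_iff_obsInclWith (expresses_initials hF)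
      ((expresses_initials hF).expressesSup hF fun _ _ => Iff.rfl) Y p q
  | T =>
    exact obsLEWith_iff_obsInclWith (expresses_traces hF)
      ((expresses_traces hF).expressesSup hF fun _ _ => Iff.rfl) Y p q
  | S =>
    exact obsLEWith_iff_obsInclWith (expresses_simulation hF)
      ((expresses_simulation hF).expressesSup hF fun _ _ => Iff.rfl) Y p q

end Unified

theorem mainTheorem3 {Act P : Type*} (tr : P → Act → P → Prop) (N : Constraint) (Y : SemKind)
    (p q : P) (hp : ImageFinite tr p) (hq : ImageFinite tr q) :
    (LogicLE tr (unifiedLogic N Y) p q ↔ ObsLE tr N Y p q) ∧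
    ((N = Constraint.C → Finite Act) →
      (LogicLE tr (finitaryLogic N Y) p q ↔ ObsLE tr N Y p q)) ∧
    (ObsLE tr N Y p q ↔ ObsIncl tr N Y p q) := by
  refine ⟨?_, fun hAct => ?_, obsLE_iff_obsIncl N Y p q⟩
  · rw [← logicLE_iff_obsLE finitelyClosed_true (fun _ => trivial) Y hp hq]
    exact ⟨fun h φ hφ => h φ hφ.1, fun h φ hφ => h φ ⟨hφ, trivial⟩⟩
  · refine logicLE_iff_obsLE finitelyClosed_finitary (fun hN => ?_) Y hp hq
    have := hAct hN
    exact finitary_nonzero
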